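/- Let $M$ be a natural number, and for $i,j\in\{1,\dots,M\}$ let $A_{ij}\in\mathbb R^{m_i\times n_j}$, $B_{ij}\in\mathbb R^{p_i\times n_j}$, $b_i\in\mathbb R^{m_i}$. Consider the problem $$\text{minimize }\sum_{i=1}^M\Big\{f_i(x_i)+h_i(x_i)+g_i\Big(\sum_j B_{ij}x_j\Big)\Big\}\quad\text{subject to }\sum_j A_{ij}x_j=b_i,\ i=1,\dots,M,$$ under the following assumptions. (a) Each $f_i:\mathbb R^{n_i}\to\mathbb R$ is differentiable and strongly convex with a symmetric positive definite matrix $H_i$, that is, $f_i(x)\ge f_i(x')+\langle\nabla f_i(x'),x-x'\rangle+\frac12\|x-x'\|_{H_i}^2$ for all $x,x'$, where $\|x\|_H^2=x^THx$. (b) All $h_i:\mathbb R^{n_i}\to\mathbb R\cup\{\infty\}$ and $g_i:\mathbb R^{p_i}\to\mathbb R\cup\{\infty\}$ are proper, closed and convex. (c) The matrix $A=(A_{ij})$ has full row rank. Notation. $C_{ij}=\begin{bmatrix}A_{ij}\\B_{ij}\end{bmatrix}$, $C=(C_{ij})$, $H=\mathrm{blkdiag}(H_1,\dots,H_M)$,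 $\mathcal N_i=\{j: A_{ij}\ne0\text{ or }B_{ij}\ne0\}$, $\mathcal M_i=\{j: A_{ji}\ne0\text{ or }B_{ji}\ne0\}$, and $C_{\mathcal M_i}$ is the stack of the blocks $C_{ji}$, $j\in\mathcal M_i$. Dual variables are $\nu=(\nu_1,\dots,\nu_M)$ with $\nu_i=(\lambda_i,\mu_i)\in\mathbb R^{m_i}\times\mathbb R^{p_i}$; further $c_i=(b_i,0)$, $F(x)=\sum_i f_i(x_i)+h_i(x_i)$, $g(y)=\sum_i g_i(y_i)$, $\varphi^\star(y)=\sup_x\{y^Tx-\varphi(x)\}$, and the dual objective is $D(\nu)=-F^\star(-C^T\nu)-c^T\nu-g^\star(\mu)$. For $\mathbf L\succ0$, $\mathrm{prox}^{\mathbf L}_\psi(x)=\arg\min_y\{\psi(y)+\frac12\|y-x\|_{\mathbf L}^2\}$. Distributed initialization. For each $i$ choose a block-diagonal positive definite $\mathbf L_{\mathcal M_i}=\mathrm{blkdiag}(\mathbf L_{\mathcal M_i,j})_{j\in\mathcal M_i}$ with positive definite blocks $\mathbf L_{\mathcal M_i,j}\in\mathbb R^{(m_j+p_j)\times(m_j+p_j)}$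 and $\mathbf L_{\mathcal M_i}\succeq C_{\mathcal M_i}H_i^{-1}C_{\mathcal M_i}^T$. Set $\mathbf L_i=\sum_{j\in\mathcal N_i}\mathbf L_{\mathcal M_j,i}$ and $\mathbf L=\mathrm{blkdiag}(\mathbf L_1,\dots,\mathbf L_M)$. Distributed generalized fast dual gradient method. Given $\lambda^0,\mu^0$, put $z^1=\lambda^0$, $v^1=\mu^0$, $t^1=1$, and for $k\ge1$ and every node $i$ let $$y_i^k=\arg\min_{x}\Big\{f_i(x)+h_i(x)+x^T\sum_{j\in\mathcal M_i}\big(A_{ji}^Tz_j^k+B_{ji}^Tv_j^k\big)\Big\},$$ $$(\lambda_i^k,\mu_i^k)=\mathrm{prox}^{\mathbf L_i}_{\tilde g_i}\Big((z_i^k,v_i^k)+\mathbf L_i^{-1}\Big(\sum_{j\in\mathcal N_i}C_{ij}y_j^k-c_i\Big)\Big),\qquad \tilde g_i(\lambda_i,\mu_i)=g_i^\star(\mu_i),$$ $$t^{k+1}=\tfrac{1+\sqrt{1+4(t^k)^2}}2,\quad z_i^{k+1}=\lambda_i^k+\tfrac{t^k-1}{t^{k+1}}(\lambda_i^k-\lambda_i^{k-1}),\quad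 v_i^{k+1}=\mu_i^k+\tfrac{t^k-1}{t^{k+1}}(\mu_i^k-\mu_i^{k-1}).$$ If $\mathbf L_i=\mathrm{blkdiag}(\mathbf L_{\lambda i},\mathbf L_{\mu i})$ for all $i$, the second line may be replaced by the separate updates $$\lambda_i^k=z_i^k+\mathbf L_{\lambda i}^{-1}\Big(\sum_{j\in\mathcal N_i}A_{ij}y_j^k-b_i\Big),\qquad \mu_i^k=\mathrm{prox}^{\mathbf L_{\mu i}}_{g_i^\star}\Big(v_i^k+\mathbf L_{\mu i}^{-1}\sum_{j\in\mathcal N_i}B_{ij}y_j^k\Big).$$ Proposition. Let $\mathbf L_1,\dots,\mathbf L_M$ be computed by the distributed initialization. Then $\mathbf L\succeq CH^{-1}C^T$. If moreover all $\mathbf L_i$ are positive definite, then for all $\lambda^0,\mu^0$ the method, with the joint updates and (when every $\mathbf L_i=\mathrm{blkdiag}(\mathbf L_{\lambda i},\mathbf L_{\mu i})$) also with the separate updates, can be carried out (all minimizers exist), and every sequence it generates satisfies, for every maximizer $\nu^\star$ of $D$ and with $\nu^k=(\lambda^k,\mu^k)$, $$D(\nu^\star)-D(\nu^k)\le\frac{2\|\nu^\star-\nu^0\|_{\mathbf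 L}^2}{(k+1)^2}\qquad\text{for all }k\ge1,$$ where $D(\nu^\star)$ and $D(\nu^k)$ are finite. -/

import Mathlib

open scoped Matrix

noncomputable section

namespace DualMPC

/-! ### Convex analysis on `ℝ^κ`, with extended-valued functions -/

/-- The squared seminorm `‖x‖_L² = xᵀ L x`. -/
def normSq {κ : Type*} [Fintype κ] (L : Matrix κ κ ℝ) (x : κ → ℝ) : ℝ :=
  x ⬝ᵥ (L *ᵥ x)

/-- Proper: never `-∞` and not identically `+∞`. -/
def Proper {κ : Type*} (φ : (κ → ℝ) → EReal) : Prop :=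
  (∀ x, φ x ≠ ⊥) ∧ ∃ x, φ x ≠ ⊤

/-- An extended-valued function is convex when its epigraph is convex. -/
def ConvexFun {κ : Type*} (φ : (κ → ℝ) → EReal) : Prop :=
  Convex ℝ {q : (κ → ℝ) × ℝ | φ q.1 ≤ (q.2 : EReal)}

/-- The conjugate function `φ⋆(y) = sup_x { yᵀ x - φ x }`. -/
def conj {κ : Type*} [Fintype κ] (φ : (κ → ℝ) → EReal) (y : κ → ℝ) : EReal :=
  ⨆ x : κ → ℝ, ((y ⬝ᵥ x : ℝ) : EReal) - φ x

/-- `x ∈ argmin φ`. -/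
def IsArgmin {κ : Type*} (φ : (κ → ℝ) → EReal) (x : κ → ℝ) : Prop :=
  IsMinOn φ Set.univ x

/-- `y = prox_ψ^L(x)`, i.e. `y` minimizes `ψ(y) + ½ ‖y - x‖_L²`. -/
def IsProx {κ : Type*} [Fintype κ] (ψ : (κ → ℝ) → EReal) (L : Matrix κ κ ℝ)
    (x y : κ → ℝ) : Prop :=
  IsArgmin (fun w => ψ w + ((1 / 2 * normSq L (w - x) : ℝ) : EReal)) y

/-- A differentiable function is strongly convex with the positive definite matrix `H` if
`φ x₁ ≥ φ x₂ + ⟨∇φ x₂, x₁ - x₂⟩ + ½ ‖x₁ - x₂‖_H²`. -/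
def StronglyConvexWith {κ : Type*} [Fintype κ] (φ : (κ → ℝ) → ℝ) (H : Matrix κ κ ℝ) : Prop :=
  H.PosDef ∧ Differentiable ℝ φ ∧
    ∀ x₁ x₂, φ x₂ + fderiv ℝ φ x₂ (x₁ - x₂) + 1 / 2 * normSq H (x₁ - x₂) ≤ φ x₁

/-! ### The structured optimization problem

`minimize ∑ i, f_i(x_i) + h_i(x_i) + g_i(∑ j, B_ij x_j)` subject to `∑ j, A_ij x_j = b_i`. -/

/-- The data of the problem with `M` nodes and block sizes `n_i`, `m_i`, `p_i`. -/
structure Problem {M : ℕ} (n m p : Fin M → ℕ) where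
  f : ∀ i, (Fin (n i) → ℝ) → ℝ
  h : ∀ i, (Fin (n i) → ℝ) → EReal
  g : ∀ i, (Fin (p i) → ℝ) → EReal
  H : ∀ i, Matrix (Fin (n i)) (Fin (n i)) ℝ
  A : ∀ i j, Matrix (Fin (m i)) (Fin (n j)) ℝ
  B : ∀ i j, Matrix (Fin (p i)) (Fin (n j)) ℝ
  b : ∀ i, Fin (m i) → ℝ

/-- Index type of the local dual variable `ν_i = (λ_i, μ_i)`. -/
abbrev LocalIdx {M : ℕ} (m p : Fin M → ℕ) (i : Fin M) : Type := Fin (m i) ⊕ Fin (p i)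

/-- Index type of the dual variable `ν = (ν_1, …, ν_M)`. -/
abbrev DualIdx {M : ℕ} (m p : Fin M → ℕ) : Type := Σ i : Fin M, LocalIdx m p i

/-- Index type of the primal variable `x = (x_1, …, x_M)`. -/
abbrev PrimalIdx {M : ℕ} (n : Fin M → ℕ) : Type := Σ i : Fin M, Fin (n i)

namespace Problem

variable {M : ℕ} {n m p : Fin M → ℕ}

/-- The full matrix `A` with blocks `A_ij`. -/
def fullA (P : Problem n m p) : Matrix (Σ i, Fin (m i)) (PrimalIdx n) ℝ :=
  Matrix.of fun r c => P.A r.1 c.1 r.2 c.2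

/-- Standing assumptions on the problem. -/
structure Assumptions (P : Problem n m p) : Prop where
  strong : ∀ i, StronglyConvexWith (P.f i) (P.H i)
  h_proper : ∀ i, Proper (P.h i)
  h_closed : ∀ i, LowerSemicontinuous (P.h i)
  h_convex : ∀ i, ConvexFun (P.h i)
  g_proper : ∀ i, Proper (P.g i)
  g_closed : ∀ i, LowerSemicontinuous (P.g i)
  g_convex : ∀ i, ConvexFun (P.g i)
  full_row_rank : LinearIndependent ℝ P.fullA.row

/-- The block `C_ij`, that is `A_ij` stacked on `B_ij`. -/
def blockC (P : Problem n m p) (i j : Fin M) : Matrix (LocalIdx m p i) (Fin (n j)) ℝ :=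
  Matrix.fromRows (P.A i j) (P.B i j)

/-- The full matrix `C` with blocks `C_ij`, the rows being ordered node by node. -/
def fullC (P : Problem n m p) : Matrix (DualIdx m p) (PrimalIdx n) ℝ :=
  Matrix.of fun r c => P.blockC r.1 c.1 r.2 c.2

/-- `H = blkdiag(H_1, …, H_M)`. -/
def fullH (P : Problem n m p) : Matrix (PrimalIdx n) (PrimalIdx n) ℝ :=
  Matrix.blockDiagonal' P.H

open Classical in
/-- `𝒩_i`: the nodes `j` such that block `(i, j)` of `A` or of `B` is non-zero. -/
def nbrN (P : Problem n m p) (i : Fin M) : Finset (Fin M) :=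
  Finset.univ.filter fun j => P.A i j ≠ 0 ∨ P.B i j ≠ 0

open Classical in
/-- `ℳ_i`: the nodes `j` such that block `(j, i)` of `A` or of `B` is non-zero. -/
def nbrM (P : Problem n m p) (i : Fin M) : Finset (Fin M) :=
  Finset.univ.filter fun j => P.A j i ≠ 0 ∨ P.B j i ≠ 0

/-! ### The dual problem -/

/-- `F(x) = ∑ i, f_i(x_i) + h_i(x_i)`. -/
def sumF (P : Problem n m p) (x : PrimalIdx n → ℝ) : EReal :=
  ∑ i, ((P.f i (fun a => x ⟨i, a⟩) : EReal) + P.h i (fun a => x ⟨i, a⟩))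

/-- `g(y) = ∑ i, g_i(y_i)`. -/
def sumG (P : Problem n m p) (y : (Σ i, Fin (p i)) → ℝ) : EReal :=
  ∑ i, P.g i (fun a => y ⟨i, a⟩)

/-- `c_i = (b_i, 0)`, stacked over the nodes. -/
def vecC (P : Problem n m p) : DualIdx m p → ℝ :=
  fun s => Sum.elim (P.b s.1) (fun _ => 0) s.2

/-- `d(ν) = -F⋆(-Cᵀ ν) - cᵀ ν`. -/
def d (P : Problem n m p) (ν : DualIdx m p → ℝ) : EReal :=
  -conj P.sumF (-(P.fullCᵀ *ᵥ ν)) - ((P.vecC ⬝ᵥ ν : ℝ) : EReal)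

/-- The dual objective `D(ν) = d(ν) - g⋆(μ)`, where `ν = (λ, μ)`. -/
def D (P : Problem n m p) (ν : DualIdx m p → ℝ) : EReal :=
  P.d ν - conj P.sumG (fun s => ν ⟨s.1, Sum.inr s.2⟩)

/-! ### The distributed initialization -/

/-- `C_{ℳ_i}`: the blocks `C_ji` with `j ∈ ℳ_i` stacked on each other. -/
def locC (P : Problem n m p) (i : Fin M) :
    Matrix (Σ j : {j // j ∈ P.nbrM i}, LocalIdx m p j.1) (Fin (n i)) ℝ :=
  Matrix.of fun r c => P.blockC r.1.1 i r.2 c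

/-- The set of admissible local matrices `L_{ℳ_i}`: positive definite, at least
`C_{ℳ_i} H_i⁻¹ C_{ℳ_i}ᵀ`, and block diagonal with positive definite blocks. -/
def locSet (P : Problem n m p) (i : Fin M) :
    Set (Matrix (Σ j : {j // j ∈ P.nbrM i}, LocalIdx m p j.1)
      (Σ j : {j // j ∈ P.nbrM i}, LocalIdx m p j.1) ℝ) :=
  {L | L.PosDef ∧ (L - P.locC i * (P.H i)⁻¹ * (P.locC i)ᵀ).PosSemidef ∧
    ∃ K : ∀ j : {j // j ∈ P.nbrM i}, Matrix (LocalIdx m p j.1) (LocalIdx m p j.1) ℝ,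
      (∀ j, (K j).PosDef) ∧ L = Matrix.blockDiagonal' K}

/-- `L_i = ∑ j ∈ 𝒩_i, L_{ℳ_j, i}`; here `K i j` stands for the block `L_{ℳ_i, j}`,
and only the blocks with `j ∈ ℳ_i` are used. -/
def initL (P : Problem n m p)
    (K : ∀ _ j : Fin M, Matrix (LocalIdx m p j) (LocalIdx m p j) ℝ) (i : Fin M) :
    Matrix (LocalIdx m p i) (LocalIdx m p i) ℝ :=
  ∑ j ∈ P.nbrN i, K j i

end Problem

/-! ### The distributed generalized fast dual gradient method -/

/-- The iterates; `lam` and `mu` are indexed by `k ≥ 0`, the other ones by `k ≥ 1`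
(their entries at `0` play no role). -/
structure Iterates {M : ℕ} (n m p : Fin M → ℕ) where
  y : ℕ → ∀ i, Fin (n i) → ℝ
  lam : ℕ → ∀ i, Fin (m i) → ℝ
  mu : ℕ → ∀ i, Fin (p i) → ℝ
  z : ℕ → ∀ i, Fin (m i) → ℝ
  v : ℕ → ∀ i, Fin (p i) → ℝ
  t : ℕ → ℝ

/-- The stacked dual vector `ν = (ν_1, …, ν_M)` with `ν_i = (λ_i, μ_i)`. -/
def stack {M : ℕ} {m p : Fin M → ℕ} (lam : ∀ i, Fin (m i) → ℝ) (mu : ∀ i, Fin (p i) → ℝ) :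
    DualIdx m p → ℝ :=
  fun s => Sum.elim (lam s.1) (mu s.1) s.2

namespace Problem

variable {M : ℕ} {n m p : Fin M → ℕ}

/-- `A_{𝒩_i} y_{𝒩_i} - b_i`. -/
def resA (P : Problem n m p) (y : ∀ i, Fin (n i) → ℝ) (i : Fin M) : Fin (m i) → ℝ :=
  (∑ j ∈ P.nbrN i, P.A i j *ᵥ y j) - P.b i

/-- `B_{𝒩_i} y_{𝒩_i}`. -/
def resB (P : Problem n m p) (y : ∀ i, Fin (n i) → ℝ) (i : Fin M) : Fin (p i) → ℝ :=
  ∑ j ∈ P.nbrN i, P.B i j *ᵥ y j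

/-- Everything in the method except the update of `λ_i` and `μ_i`: initialization from
`λ⁰, μ⁰`, primal update, step-size sequence, and extrapolation. -/
structure CommonSteps (P : Problem n m p) (lam0 : ∀ i, Fin (m i) → ℝ)
    (mu0 : ∀ i, Fin (p i) → ℝ) (S : Iterates n m p) : Prop where
  lam_init : S.lam 0 = lam0
  mu_init : S.mu 0 = mu0
  z_init : S.z 1 = lam0
  v_init : S.v 1 = mu0
  t_init : S.t 1 = 1
  y_step : ∀ k, 1 ≤ k → ∀ i,
    IsArgmin (fun x : Fin (n i) → ℝ => (P.f i x : EReal) + P.h i x +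
      ((x ⬝ᵥ ((∑ j ∈ P.nbrM i, (P.A j i)ᵀ *ᵥ S.z k j) +
        (∑ j ∈ P.nbrM i, (P.B j i)ᵀ *ᵥ S.v k j)) : ℝ) : EReal)) (S.y k i)
  t_step : ∀ k, 1 ≤ k → S.t (k + 1) = (1 + √(1 + 4 * S.t k ^ 2)) / 2
  z_step : ∀ k, 1 ≤ k → ∀ i,
    S.z (k + 1) i = S.lam k i + ((S.t k - 1) / S.t (k + 1)) • (S.lam k i - S.lam (k - 1) i)
  v_step : ∀ k, 1 ≤ k → ∀ i,
    S.v (k + 1) i = S.mu k i + ((S.t k - 1) / S.t (k + 1)) • (S.mu k i - S.mu (k - 1) i)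

/-- A run of the method with `L_i = blkdiag(L_{λ i}, L_{μ i})`:
`λ_i^k = z_i^k + L_{λ i}⁻¹ (A_{𝒩_i} y_{𝒩_i}^k - b_i)` and
`μ_i^k = prox_{g_i⋆}^{L_{μ i}} (v_i^k + L_{μ i}⁻¹ B_{𝒩_i} y_{𝒩_i}^k)`. -/
structure IsSplitRun (P : Problem n m p) (Ll : ∀ i, Matrix (Fin (m i)) (Fin (m i)) ℝ)
    (Lm : ∀ i, Matrix (Fin (p i)) (Fin (p i)) ℝ) (lam0 : ∀ i, Fin (m i) → ℝ)
    (mu0 : ∀ i, Fin (p i) → ℝ) (S : Iterates n m p) : Prop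
    extends CommonSteps P lam0 mu0 S where
  lam_step : ∀ k, 1 ≤ k → ∀ i, S.lam k i = S.z k i + (Ll i)⁻¹ *ᵥ P.resA (S.y k) i
  mu_step : ∀ k, 1 ≤ k → ∀ i,
    IsProx (conj (P.g i)) (Lm i) (S.v k i + (Lm i)⁻¹ *ᵥ P.resB (S.y k) i) (S.mu k i)

/-- A run of the method with arbitrary local matrices `L_i`, where `λ_i` and `μ_i` are updated
jointly by the prox step of the function `(λ_i, μ_i) ↦ g_i⋆(μ_i)`. -/
structure IsJointRun (P : Problem n m p)
    (L : ∀ i, Matrix (LocalIdx m p i) (LocalIdx m p i) ℝ) (lam0 : ∀ i, Fin (m i) → ℝ)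
    (mu0 : ∀ i, Fin (p i) → ℝ) (S : Iterates n m p) : Prop
    extends CommonSteps P lam0 mu0 S where
  dual_step : ∀ k, 1 ≤ k → ∀ i,
    IsProx (fun w : LocalIdx m p i → ℝ => conj (P.g i) (fun a => w (Sum.inr a))) (L i)
      (Sum.elim (S.z k i) (S.v k i) +
        (L i)⁻¹ *ᵥ Sum.elim (P.resA (S.y k) i) (P.resB (S.y k) i))
      (Sum.elim (S.lam k i) (S.mu k i))

/-- Rate `D(ν⋆) - D(ν^k) ≤ 2 ‖ν⋆ - ν⁰‖_L² / (k+1)²` for all `k ≥ 1` and every dual optimal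
point `ν⋆`, where `ν^k = (λ^k, μ^k)`; the dual values involved are finite. -/
def HasRate (P : Problem n m p) (L : ∀ i, Matrix (LocalIdx m p i) (LocalIdx m p i) ℝ)
    (S : Iterates n m p) : Prop :=
  ∀ νs : DualIdx m p → ℝ, IsMaxOn P.D Set.univ νs → ∀ k : ℕ, 1 ≤ k →
    (P.D νs ≠ ⊥ ∧ P.D νs ≠ ⊤) ∧
    (P.D (stack (S.lam k) (S.mu k)) ≠ ⊥ ∧ P.D (stack (S.lam k) (S.mu k)) ≠ ⊤) ∧
    P.D νs - P.D (stack (S.lam k) (S.mu k)) ≤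
      ((2 * normSq (Matrix.blockDiagonal' L) (νs - stack (S.lam 0) (S.mu 0)) /
        ((k : ℝ) + 1) ^ 2 : ℝ) : EReal)

end Problem

end DualMPC

end

noncomputable section

namespace DualMPC

/-! ### Quadratic forms -/

section Quadratic

variable {κ : Type*} [Fintype κ] {L : Matrix κ κ ℝ}

/-! The method is an accelerated proximal gradient scheme for `-D` in the metric `L`. Writing `D = d
- g⋆`, two facts about `d` drive it.

First, `L ⪰ C H⁻¹ Cᵀ`: both quadratic forms are sums of local forms over the nodes, so the local
inequalities add up (`posSemidef_initL_sub`).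

Second, if `y` minimizes the Lagrangian at `ν`, then `C y - c` is a supergradient of `d` at `ν`
(`IsPrimalMin.dualVal_le`), and `d` lies above that linearization minus `½‖·‖_L²`
(`IsPrimalMin.le_dualVal`). The lower bound comes from quadratic growth of the Lagrangian and
Young's inequality; differentiability of `d` is never used. Together with quadratic growth of the
prox objective (`IsProx.three_point`) this gives `dual_step_inequality`, which compares a new
iterate with any dual point where `g⋆` is finite. Using it at the maximizer and at the previous
iterate feeds the potential argument of `accelerated_rate`.

All minimizers exist because a closed proper convex function has an affine minorant (Hahn–Banach),
so adding a function with quadratic growth makes it coercive. The separate updates are the joint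
ones in disguise (`isSplitRun_iff`). -/

lemma normSq_smul (L : Matrix κ κ ℝ) (a : ℝ) (x : κ → ℝ) :
    normSq L (a • x) = a ^ 2 * normSq L x := by
  simp only [normSq, Matrix.mulVec_smul, smul_dotProduct, dotProduct_smul, smul_eq_mul]
  ring

lemma dotProduct_mulVec_comm (hL : L.IsHermitian) (x y : κ → ℝ) :
    x ⬝ᵥ (L *ᵥ y) = y ⬝ᵥ (L *ᵥ x) := by
  have hT : Lᵀ = L := (Matrix.conjTranspose_eq_transpose_of_trivial L).symm.trans hL
  rw [Matrix.dotProduct_mulVec, ← Matrix.mulVec_transpose, hT, dotProduct_comm]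

lemma normSq_add (hL : L.IsHermitian) (x y : κ → ℝ) :
    normSq L (x + y) = normSq L x + 2 * (x ⬝ᵥ (L *ᵥ y)) + normSq L y := by
  simp only [normSq, Matrix.mulVec_add, add_dotProduct, dotProduct_add]
  rw [dotProduct_mulVec_comm hL y x]
  ring

lemma normSq_sub (hL : L.IsHermitian) (x y : κ → ℝ) :
    normSq L (x - y) = normSq L x - 2 * (x ⬝ᵥ (L *ᵥ y)) + normSq L y := by
  simp only [normSq, Matrix.mulVec_sub, sub_dotProduct, dotProduct_sub]
  rw [dotProduct_mulVec_comm hL y x]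
  ring

lemma normSq_nonneg (hL : L.PosSemidef) (x : κ → ℝ) : 0 ≤ normSq L x := by
  simpa [normSq] using hL.dotProduct_mulVec_nonneg x

/-- The linear functional `x ↦ x ⬝ᵥ w`. -/
def dotRight (w : κ → ℝ) : (κ → ℝ) →L[ℝ] ℝ :=
  LinearMap.toContinuousLinearMap
    { toFun := fun x => x ⬝ᵥ w, map_add' := fun _ _ => add_dotProduct _ _ _,
      map_smul' := fun _ _ => smul_dotProduct _ _ _ }

@[simp] lemma dotRight_apply (w x : κ → ℝ) : dotRight w x = x ⬝ᵥ w := rfl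

lemma continuous_normSq (L : Matrix κ κ ℝ) : Continuous (normSq L) := by
  unfold normSq
  fun_prop

/-- The constant is the minimum of the form on the compact unit sphere, spread to all vectors by
homogeneity. The sphere is empty exactly in dimension zero, where any constant works. -/
lemma exists_pos_le_normSq (hL : L.PosDef) : ∃ α > 0, ∀ x, α * ‖x‖ ^ 2 ≤ normSq L x := by
  rcases (Metric.sphere (0 : κ → ℝ) 1).eq_empty_or_nonempty with h | h
  · refine ⟨1, one_pos, fun x => ?_⟩
    have hx : x = 0 := by
      by_contra hx
      have : (‖x‖⁻¹ • x) ∈ Metric.sphere (0 : κ → ℝ) 1 := by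
        simp [norm_smul, hx]
      simp [h] at this
    simp [hx, normSq]
  · obtain ⟨s, hs, hmin⟩ := (isCompact_sphere (0 : κ → ℝ) 1).exists_isMinOn h
      (continuous_normSq L).continuousOn
    have hs0 : s ≠ 0 := by
      rintro rfl
      simp at hs
    refine ⟨normSq L s, by simpa [normSq] using hL.dotProduct_mulVec_pos hs0, fun x => ?_⟩
    by_cases hx : x = 0
    · simp [hx, normSq]
    have hn : 0 < ‖x‖ := norm_pos_iff.2 hx
    have hm : (‖x‖⁻¹ • x) ∈ Metric.sphere (0 : κ → ℝ) 1 := by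
      simp [norm_smul, hx]
    have h1 : normSq L s ≤ normSq L (‖x‖⁻¹ • x) := hmin hm
    rw [normSq_smul, inv_pow, inv_mul_eq_div, le_div_iff₀ (by positivity)] at h1
    exact h1

/-- Young's inequality for the quadratic forms of `H` and `H⁻¹`. -/
lemma neg_half_normSq_inv_le [DecidableEq κ] {H : Matrix κ κ ℝ} (hH : H.PosDef) (u s : κ → ℝ) :
    -(1 / 2 * normSq H⁻¹ s) ≤ 1 / 2 * normSq H u + u ⬝ᵥ s := by
  have h0 := normSq_nonneg hH.posSemidef (u + H⁻¹ *ᵥ s)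
  have hdet : IsUnit H.det := (Matrix.isUnit_iff_isUnit_det _).1 hH.isUnit
  have hHs : H *ᵥ (H⁻¹ *ᵥ s) = s := by
    rw [Matrix.mulVec_mulVec, Matrix.mul_nonsing_inv _ hdet, Matrix.one_mulVec]
  have h1 : normSq H (H⁻¹ *ᵥ s) = normSq H⁻¹ s := by
    simp only [normSq, hHs]
    exact dotProduct_comm _ _
  rw [normSq_add hH.1, hHs, h1] at h0
  linarith

/-- A quadratic form satisfies the strong convexity identity along segments. -/
lemma half_normSq_segment (hL : L.IsHermitian) (u x y : κ → ℝ) (t : ℝ) :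
    1 / 2 * normSq L (y + t • (x - y) - u) =
      (1 - t) * (1 / 2 * normSq L (y - u)) + t * (1 / 2 * normSq L (x - u))
        - t * (1 - t) / 2 * normSq L (x - y) := by
  have e1 : y + t • (x - y) - u = (y - u) + t • (x - y) := by abel
  have e2 : x - u = (y - u) + (x - y) := by abel
  rw [e1, e2, normSq_add hL, normSq_add hL, normSq_smul]
  simp only [Matrix.mulVec_smul, dotProduct_smul, smul_eq_mul]
  ring

end Quadratic

/-! ### Minimizers of strongly convex functions -/

section Argmin

variable {κ : Type*}

lemma ConvexFun.segment_le {φ : (κ → ℝ) → EReal} (hφ : ConvexFun φ) {x y : κ → ℝ} {a b t : ℝ}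
    (hy : φ y ≤ a) (hx : φ x ≤ b) (h0 : 0 ≤ t) (h1 : t ≤ 1) :
    φ (y + t • (x - y)) ≤ (((1 - t) * a + t * b : ℝ) : EReal) := by
  have := hφ (x := (y, a)) hy (y := (x, b)) hx (sub_nonneg.2 h1) h0 (by ring)
  simp only [Set.mem_ofPred_eq, Prod.fst_add, Prod.smul_fst, Prod.snd_add, Prod.smul_snd,
    smul_eq_mul] at this
  convert this using 2
  module

lemma IsArgmin.le {φ : (κ → ℝ) → EReal} {y : κ → ℝ} (h : IsArgmin φ y) (x : κ → ℝ) :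
    φ y ≤ φ x := h (Set.mem_univ x)

lemma Proper.coe_toReal {φ : (κ → ℝ) → EReal} (hφ : Proper φ) {x : κ → ℝ} (hx : φ x ≠ ⊤) :
    ((φ x).toReal : EReal) = φ x :=
  EReal.coe_toReal hx (hφ.1 x)

lemma IsArgmin.ne_top {φ : (κ → ℝ) → EReal} (hφ : Proper φ) {q : (κ → ℝ) → ℝ} {y : κ → ℝ}
    (h : IsArgmin (fun x => φ x + (q x : EReal)) y) : φ y ≠ ⊤ := by
  obtain ⟨x, hx⟩ := hφ.2
  intro hy
  have := h.le x
  simp only [hy, EReal.top_add_coe, top_le_iff] at this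
  rw [← hφ.coe_toReal hx, ← EReal.coe_add] at this
  exact EReal.coe_ne_top _ this

lemma lowerSemicontinuous_add_coe {φ : (κ → ℝ) → EReal} (hφ : LowerSemicontinuous φ)
    {q : (κ → ℝ) → ℝ} (hq : Continuous q) :
    LowerSemicontinuous fun x => φ x + (q x : EReal) :=
  hφ.add' (continuous_coe_real_ereal.comp hq).lowerSemicontinuous fun _ =>
    EReal.continuousAt_add (.inr (EReal.coe_ne_bot _)) (.inr (EReal.coe_ne_top _))

variable [Fintype κ]

/-- Quadratic growth at a minimizer of the sum of a convex and a strongly convex function. -/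
lemma IsArgmin.add_half_normSq_le {φ : (κ → ℝ) → EReal} (hc : ConvexFun φ) {q : (κ → ℝ) → ℝ}
    {H : Matrix κ κ ℝ}
    (hq : ∀ x y t, 0 ≤ t → t ≤ 1 → q (y + t • (x - y)) ≤
      (1 - t) * q y + t * q x - t * (1 - t) / 2 * normSq H (x - y))
    {x y : κ → ℝ} (h : IsArgmin (fun x => φ x + (q x : EReal)) y) {a b : ℝ}
    (hy : φ y = a) (hx : φ x = b) :
    a + q y + 1 / 2 * normSq H (x - y) ≤ b + q x := by
  set N := normSq H (x - y) with hN
  have key : ∀ t : ℝ, 0 < t → t < 1 → N / 2 - t * (N / 2) ≤ b + q x - (a + q y) := by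
    intro t ht0 ht1
    have h1 := h.le (y + t • (x - y))
    have h2 := hc.segment_le hy.le hx.le ht0.le ht1.le
    have h3 := h1.trans (add_le_add_left h2 _)
    simp only [hy] at h3
    rw [← EReal.coe_add, ← EReal.coe_add, EReal.coe_le_coe_iff] at h3
    have h4 := hq x y t ht0.le ht1.le
    rw [← hN] at h4
    have h5 : t * (N / 2 - t * (N / 2)) ≤ t * (b + q x - (a + q y)) := by linarith
    exact le_of_mul_le_mul_left h5 ht0
  -- This stands for letting `t → 0` in `key`. With gap `ε`, the choice `t = ε / (ε + |N| + 1)`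
  -- turns `ε ≤ t * (N / 2)` into `ε + |N| + 1 ≤ N / 2`, which is absurd.
  by_contra! hlt
  set ε := N / 2 - (b + q x - (a + q y)) with hε
  have hε0 : 0 < ε := by linarith
  have hd : 0 < ε + |N| + 1 := by positivity
  have h1 := key (ε / (ε + |N| + 1)) (by positivity) (by
    rw [div_lt_one hd]
    linarith [abs_nonneg N])
  have h2 : ε ≤ ε / (ε + |N| + 1) * (N / 2) := by linarith
  rw [div_mul_eq_mul_div, le_div_iff₀ hd] at h2
  have h3 := le_of_mul_le_mul_left h2 hε0
  linarith [abs_nonneg N, le_abs_self N]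

/-- The first-order inequality is taken at the intermediate point towards both ends, with weights
`t` and `1 - t`. The gradient terms cancel, and the quadratic ones combine by `t(1-t)² + (1-t)t² =
t(1-t)`. -/
lemma StronglyConvexWith.segment_le {f : (κ → ℝ) → ℝ} {H : Matrix κ κ ℝ}
    (hf : StronglyConvexWith f H) (w x y : κ → ℝ) (t : ℝ) (h0 : 0 ≤ t) (h1 : t ≤ 1) :
    f (y + t • (x - y)) + (y + t • (x - y)) ⬝ᵥ w ≤
      (1 - t) * (f y + y ⬝ᵥ w) + t * (f x + x ⬝ᵥ w) - t * (1 - t) / 2 * normSq H (x - y) := by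
  have ha := hf.2.2 x (y + t • (x - y))
  have hb := hf.2.2 y (y + t • (x - y))
  have ea : x - (y + t • (x - y)) = (1 - t) • (x - y) := by module
  have eb : y - (y + t • (x - y)) = (-t) • (x - y) := by module
  rw [ea, map_smul, normSq_smul, smul_eq_mul] at ha
  rw [eb, map_smul, normSq_smul, smul_eq_mul] at hb
  have ha' := mul_le_mul_of_nonneg_left ha h0
  have hb' := mul_le_mul_of_nonneg_left hb (sub_nonneg.2 h1)
  simp only [add_dotProduct, smul_dotProduct, sub_dotProduct, smul_eq_mul]
  linarith

/-- A lower semicontinuous function with quadratic growth attains its minimum. -/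
lemma exists_isArgmin {ψ : (κ → ℝ) → EReal} (hψ : LowerSemicontinuous ψ)
    (hp : ∃ x, ψ x ≠ ⊤) {H : Matrix κ κ ℝ} (hH : H.PosDef) {b : ℝ}
    (hb : ∀ x, ((1 / 2 * normSq H x - b * (1 + ‖x‖) : ℝ) : EReal) ≤ ψ x) :
    ∃ x, IsArgmin ψ x := by
  obtain ⟨x₀, hx₀⟩ := hp
  obtain ⟨α, hα, hαH⟩ := exists_pos_le_normSq hH
  have hbot : ψ x₀ ≠ ⊥ := fun h => EReal.coe_ne_bot _ (le_bot_iff.1 (h ▸ hb x₀))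
  set r := (ψ x₀).toReal with hr
  have hr' : ψ x₀ = r := (EReal.coe_toReal hx₀ hbot).symm
  -- On the sublevel set of `x₀`, if `‖x‖ > 1` then `1 + ‖x‖ ≤ 2‖x‖`, so `(α/2)‖x‖² ≤ (|r| +
  -- 2|b|)‖x‖`; dividing by `‖x‖` gives the radius.
  set R := 1 + 2 * (|r| + 2 * |b|) / α with hR
  have hR1 : 0 ≤ 2 * (|r| + 2 * |b|) / α := by positivity
  have hsub : ψ ⁻¹' Set.Iic (ψ x₀) ⊆ Metric.closedBall 0 R := by
    intro x hx
    rw [mem_closedBall_zero_iff]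
    rcases le_or_gt ‖x‖ 1 with h1 | h1
    · linarith
    have h2 := (hb x).trans hx
    rw [hr', EReal.coe_le_coe_iff] at h2
    have h3 := hαH x
    have h4 : b * (1 + ‖x‖) ≤ |b| * (2 * ‖x‖) :=
      mul_le_mul (le_abs_self b) (by linarith) (by positivity) (abs_nonneg b)
    have h5 : |r| ≤ |r| * ‖x‖ := le_mul_of_one_le_right (abs_nonneg r) h1.le
    have h6 : ‖x‖ * (‖x‖ * α) ≤ ‖x‖ * (2 * (|r| + 2 * |b|)) := by
      nlinarith [le_abs_self r]
    have h7 := le_of_mul_le_mul_left h6 (by linarith)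
    rw [← le_div_iff₀ hα] at h7
    linarith
  have hcomp : IsCompact (ψ ⁻¹' Set.Iic (ψ x₀)) :=
    (isCompact_closedBall 0 R).of_isClosed_subset (hψ.isClosed_preimage _) hsub
  obtain ⟨y, hy, hmin⟩ := LowerSemicontinuousOn.exists_isMinOn (s := ψ ⁻¹' Set.Iic (ψ x₀))
    ⟨x₀, le_refl (ψ x₀)⟩ hcomp (hψ.lowerSemicontinuousOn _)
  refine ⟨y, fun x _ => ?_⟩
  by_cases hx : ψ x ≤ ψ x₀
  · exact hmin hx
  · exact le_trans hy (not_le.1 hx).le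

/-- Affine functions are bounded below by a multiple of `1 + ‖x‖`. -/
lemma exists_neg_mul_le_affine (ℓ : (κ → ℝ) →L[ℝ] ℝ) (c : ℝ) :
    ∃ b : ℝ, ∀ x, -(b * (1 + ‖x‖)) ≤ c + ℓ x := by
  refine ⟨|c| + ‖ℓ‖, fun x => ?_⟩
  have h1 := neg_abs_le (ℓ x)
  have h2 : |ℓ x| ≤ ‖ℓ‖ * ‖x‖ := ℓ.le_opNorm x
  nlinarith [neg_abs_le c, norm_nonneg x, norm_nonneg ℓ, abs_nonneg c,
    mul_nonneg (abs_nonneg c) (norm_nonneg x)]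

lemma exists_isArgmin_add {φ : (κ → ℝ) → EReal} (hp : Proper φ) (hl : LowerSemicontinuous φ)
    (hm : ∃ (ℓ : (κ → ℝ) →L[ℝ] ℝ) (c : ℝ), ∀ x, ((c + ℓ x : ℝ) : EReal) ≤ φ x)
    {q : (κ → ℝ) → ℝ} (hq : Continuous q) {H : Matrix κ κ ℝ} (hH : H.PosDef)
    {ℓ' : (κ → ℝ) →L[ℝ] ℝ} {c' : ℝ} (hqH : ∀ x, c' + ℓ' x + 1 / 2 * normSq H x ≤ q x) :
    ∃ x, IsArgmin (fun x => φ x + (q x : EReal)) x := by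
  obtain ⟨ℓ, c, hℓ⟩ := hm
  obtain ⟨b, hb⟩ := exists_neg_mul_le_affine (ℓ + ℓ') (c + c')
  refine exists_isArgmin (lowerSemicontinuous_add_coe hl hq) ?_ hH (b := b) fun x => ?_
  · obtain ⟨x, hx⟩ := hp.2
    refine ⟨x, ?_⟩
    rw [← hp.coe_toReal hx, ← EReal.coe_add]
    exact EReal.coe_ne_top _
  · refine le_trans ?_ (add_le_add_left (hℓ x) _)
    rw [← EReal.coe_add, EReal.coe_le_coe_iff]
    have := hb x
    simp only [add_apply] at this
    linarith [hqH x]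

/-- A closed proper convex function has an affine minorant. -/
lemma exists_affine_minorant {φ : (κ → ℝ) → EReal} (hp : Proper φ)
    (hl : LowerSemicontinuous φ) (hc : ConvexFun φ) :
    ∃ (ℓ : (κ → ℝ) →L[ℝ] ℝ) (c : ℝ), ∀ x, ((c + ℓ x : ℝ) : EReal) ≤ φ x := by
  obtain ⟨x₀, hx₀⟩ := hp.2
  have hr := hp.coe_toReal hx₀
  set r := (φ x₀).toReal
  have hclosed : IsClosed {q : (κ → ℝ) × ℝ | φ q.1 ≤ (q.2 : EReal)} := by
    have : {q : (κ → ℝ) × ℝ | φ q.1 ≤ (q.2 : EReal)} =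
        (fun q : (κ → ℝ) × ℝ => (q.1, (q.2 : EReal))) ⁻¹' {p | φ p.1 ≤ p.2} := rfl
    rw [this]
    exact hl.isClosed_epigraph.preimage
      (continuous_fst.prodMk (continuous_coe_real_ereal.comp continuous_snd))
  -- A point strictly below the graph, over the domain, is separated from the epigraph. Since `(x₀,
  -- r)` lies right above it in the epigraph, the separating hyperplane is not vertical (`β > 0`),
  -- and solving for the last coordinate gives the minorant.
  have hnot : (x₀, r - 1) ∉ {q : (κ → ℝ) × ℝ | φ q.1 ≤ (q.2 : EReal)} := by
    simp only [Set.mem_ofPred_eq, ← hr, EReal.coe_le_coe_iff, not_le]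
    linarith
  obtain ⟨F, u, hF0, hF⟩ := geometric_hahn_banach_point_closed hc hclosed hnot
  have hdec : ∀ x s, F (x, s) = F (x, 0) + s * F (0, 1) := by
    intro x s
    rw [← smul_eq_mul, ← map_smul, ← map_add]
    simp
  set β := F (0, 1) with hβ
  have hβ0 : 0 < β := by
    have := hF (x₀, r) (by simp [hr])
    rw [hdec] at this hF0
    nlinarith
  refine ⟨-(β⁻¹ • F.comp (ContinuousLinearMap.inl ℝ (κ → ℝ) ℝ)), β⁻¹ * u, fun x => ?_⟩
  by_cases hx : φ x = ⊤
  · simp [hx]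
  have hs := hp.coe_toReal hx
  rw [← hs, EReal.coe_le_coe_iff]
  have := hF (x, (φ x).toReal) (by simp [hs])
  rw [hdec] at this
  simp only [neg_apply, smul_apply,
    ContinuousLinearMap.comp_apply, ContinuousLinearMap.inl_apply, smul_eq_mul]
  have h2 : β⁻¹ * u - β⁻¹ * F (x, 0) ≤ β⁻¹ * ((φ x).toReal * β) := by
    rw [← mul_sub]
    exact mul_le_mul_of_nonneg_left (by linarith) (inv_nonneg.2 hβ0.le)
  rw [mul_comm (φ x).toReal, inv_mul_cancel_left₀ hβ0.ne'] at h2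
  linarith

end Argmin

/-! ### Conjugate functions -/

section Conjugate

variable {κ : Type*} [Fintype κ] {φ : (κ → ℝ) → EReal}

lemma le_conj (φ : (κ → ℝ) → EReal) (y x : κ → ℝ) :
    ((y ⬝ᵥ x : ℝ) : EReal) - φ x ≤ conj φ y :=
  le_iSup (fun x => ((y ⬝ᵥ x : ℝ) : EReal) - φ x) x

lemma Proper.conj_ne_bot (hp : Proper φ) (y : κ → ℝ) : conj φ y ≠ ⊥ := by
  obtain ⟨x, hx⟩ := hp.2
  intro h
  have := le_conj φ y x
  rw [h, ← hp.coe_toReal hx, ← EReal.coe_sub, le_bot_iff] at this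
  exact EReal.coe_ne_bot _ this

lemma Proper.conj (hp : Proper φ) (hl : LowerSemicontinuous φ) (hc : ConvexFun φ) :
    Proper (conj φ) := by
  refine ⟨hp.conj_ne_bot, ?_⟩
  obtain ⟨ℓ, c, h⟩ := exists_affine_minorant hp hl hc
  classical
  -- The point is the slope of the affine minorant `c + ℓ`, in coordinates; there the conjugate is
  -- at most `-c`.
  refine ⟨fun i => ℓ fun j => if i = j then 1 else 0, ?_⟩
  refine ne_top_of_le_ne_top (EReal.coe_ne_top (-c)) (iSup_le fun x => ?_)
  refine EReal.sub_le_of_le_add ?_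
  refine le_trans ?_ (add_le_add_right (h x) _)
  rw [← EReal.coe_add, EReal.coe_le_coe_iff]
  have : ℓ x = ∑ i, x i • ℓ fun j => if i = j then 1 else 0 :=
    LinearMap.pi_apply_eq_sum_univ (ℓ : (κ → ℝ) →ₗ[ℝ] ℝ) x
  rw [this]
  simp [dotProduct, mul_comm]

lemma Proper.lowerSemicontinuous_conj (hp : Proper φ) : LowerSemicontinuous (DualMPC.conj φ) := by
  refine lowerSemicontinuous_iSup fun x => ?_
  by_cases hx : φ x = ⊤
  · simpa [hx] using lowerSemicontinuous_const
  · rw [← hp.coe_toReal hx]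
    simp only [← EReal.coe_sub]
    exact (continuous_coe_real_ereal.comp (by fun_prop)).lowerSemicontinuous

lemma Proper.convexFun_conj (hp : Proper φ) : ConvexFun (DualMPC.conj φ) := by
  intro q hq q' hq' a b ha hb hab
  simp only [Set.mem_ofPred_eq, DualMPC.conj, iSup_le_iff] at hq hq' ⊢
  intro x
  have h1 := hq x
  have h2 := hq' x
  by_cases hx : φ x = ⊤
  · simp [hx]
  rw [← hp.coe_toReal hx, ← EReal.coe_sub, EReal.coe_le_coe_iff] at h1 h2 ⊢
  simp only [Prod.fst_add, Prod.smul_fst, Prod.snd_add, Prod.smul_snd, smul_eq_mul,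
    add_dotProduct, smul_dotProduct]
  have hb' : b = 1 - a := by linarith
  subst hb'
  nlinarith [mul_le_mul_of_nonneg_left h1 ha, mul_le_mul_of_nonneg_left h2 hb]

lemma Proper.exists_affine_minorant_conj (hp : Proper φ) :
    ∃ (ℓ : (κ → ℝ) →L[ℝ] ℝ) (c : ℝ), ∀ y, ((c + ℓ y : ℝ) : EReal) ≤ DualMPC.conj φ y := by
  obtain ⟨x, hx⟩ := hp.2
  refine ⟨dotRight x, -(φ x).toReal, fun y => ?_⟩
  refine le_trans (le_of_eq ?_) (le_conj φ y x)
  rw [← hp.coe_toReal hx, ← EReal.coe_sub]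
  simp only [EReal.toReal_coe, EReal.coe_eq_coe_iff]
  exact neg_add_eq_sub _ _

end Conjugate

/-! ### Block diagonal matrices -/

section BlockDiagonal

lemma isHermitian_blockDiagonal' {ι : Type*} [DecidableEq ι] {κ : ι → Type*}
    {K : ∀ i, Matrix (κ i) (κ i) ℝ}
    (hK : ∀ i, (K i).IsHermitian) :
    (Matrix.blockDiagonal' K).IsHermitian := by
  rw [Matrix.IsHermitian, Matrix.blockDiagonal'_conjTranspose]
  exact congrArg _ (funext hK)

variable {ι : Type*} [Fintype ι] [DecidableEq ι] {κ : ι → Type*} [∀ i, Fintype (κ i)]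

lemma blockDiagonal'_mulVec (K : ∀ i, Matrix (κ i) (κ i) ℝ) (x : (Σ i, κ i) → ℝ)
    (s : Σ i, κ i) :
    (Matrix.blockDiagonal' K *ᵥ x) s = (K s.1 *ᵥ fun a => x ⟨s.1, a⟩) s.2 := by
  obtain ⟨i, a⟩ := s
  simp only [Matrix.mulVec, dotProduct, Fintype.sum_sigma]
  rw [Finset.sum_eq_single i]
  · simp [Matrix.blockDiagonal'_apply_eq]
  · intro j _ hj
    simp [Matrix.blockDiagonal'_apply_ne _ _ _ hj.symm]
  · simp

lemma normSq_blockDiagonal' (K : ∀ i, Matrix (κ i) (κ i) ℝ) (x : (Σ i, κ i) → ℝ) :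
    normSq (Matrix.blockDiagonal' K) x = ∑ i, normSq (K i) fun a => x ⟨i, a⟩ := by
  simp only [normSq, dotProduct, Fintype.sum_sigma, blockDiagonal'_mulVec]

lemma posDef_blockDiagonal' {K : ∀ i, Matrix (κ i) (κ i) ℝ} (hK : ∀ i, (K i).PosDef) :
    (Matrix.blockDiagonal' K).PosDef := by
  refine .of_dotProduct_mulVec_pos (isHermitian_blockDiagonal' fun i => (hK i).1) fun x hx => ?_
  have h : normSq (Matrix.blockDiagonal' K) x = _ := normSq_blockDiagonal' K x
  rw [normSq] at h
  rw [star_trivial, h]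
  obtain ⟨⟨i, a⟩, hi⟩ := Function.ne_iff.1 hx
  refine Finset.sum_pos' (fun j _ => normSq_nonneg (hK j).posSemidef _)
    ⟨i, Finset.mem_univ i, ?_⟩
  have hne : (fun a => x ⟨i, a⟩) ≠ 0 := Function.ne_iff.2 ⟨a, hi⟩
  simpa [normSq] using (hK i).dotProduct_mulVec_pos hne

lemma normSq_sub_matrix {κ : Type*} [Fintype κ] (L L' : Matrix κ κ ℝ) (x : κ → ℝ) :
    normSq (L - L') x = normSq L x - normSq L' x := by
  simp [normSq, Matrix.sub_mulVec, dotProduct_sub]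

lemma normSq_mul_mul_transpose {κ τ : Type*} [Fintype κ] [Fintype τ] (C : Matrix κ τ ℝ)
    (G : Matrix τ τ ℝ) (x : κ → ℝ) : normSq (C * G * Cᵀ) x = normSq G (Cᵀ *ᵥ x) := by
  simp only [normSq, ← Matrix.mulVec_mulVec]
  rw [Matrix.dotProduct_mulVec, ← Matrix.mulVec_transpose]

end BlockDiagonal

namespace Problem

variable {M : ℕ} {n m p : Fin M → ℕ}

/-! ### The stacked data -/

/-- The stacked primal vector. -/
def stackX (y : ∀ i, Fin (n i) → ℝ) : PrimalIdx n → ℝ := fun s => y s.1 s.2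

/-- The block of `Cᵀ ν` that belongs to node `i`. -/
def slope (P : Problem n m p) (ν : DualIdx m p → ℝ) (i : Fin M) : Fin (n i) → ℝ :=
  fun a => (P.fullCᵀ *ᵥ ν) ⟨i, a⟩

lemma mem_nbrM_iff (P : Problem n m p) (i j : Fin M) : j ∈ P.nbrM i ↔ i ∈ P.nbrN j := by
  simp [nbrM, nbrN]

lemma blockC_eq_zero (P : Problem n m p) {i j : Fin M} (h : i ∉ P.nbrN j) :
    P.blockC j i = 0 := by
  simp only [nbrN, Finset.mem_filter, Finset.mem_univ, true_and, not_or, not_not] at h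
  ext (a | a) b <;> simp [blockC, h]

lemma slope_apply (P : Problem n m p) (ν : DualIdx m p → ℝ) (i : Fin M) (a : Fin (n i)) :
    P.slope ν i a = ∑ j ∈ P.nbrM i, ((P.blockC j i)ᵀ *ᵥ fun s => ν ⟨j, s⟩) a := by
  have h : P.slope ν i a = ∑ j, ((P.blockC j i)ᵀ *ᵥ fun s => ν ⟨j, s⟩) a := by
    simp only [slope, Matrix.mulVec, dotProduct, Fintype.sum_sigma, Matrix.transpose_apply,
      fullC, Matrix.of_apply]
  rw [h]
  refine (Finset.sum_subset (Finset.subset_univ _) fun j _ hj => ?_).symm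
  rw [mem_nbrM_iff] at hj
  simp [P.blockC_eq_zero hj]

lemma slope_stack (P : Problem n m p) (lam : ∀ i, Fin (m i) → ℝ) (mu : ∀ i, Fin (p i) → ℝ)
    (i : Fin M) :
    P.slope (stack lam mu) i =
      (∑ j ∈ P.nbrM i, (P.A j i)ᵀ *ᵥ lam j) + ∑ j ∈ P.nbrM i, (P.B j i)ᵀ *ᵥ mu j := by
  ext a
  rw [slope_apply, ← Finset.sum_add_distrib, Finset.sum_apply]
  refine Finset.sum_congr rfl fun j _ => ?_
  simp [Matrix.mulVec, dotProduct, blockC, stack]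

lemma fullC_mulVec_apply (P : Problem n m p) (y : ∀ i, Fin (n i) → ℝ) (i : Fin M)
    (s : LocalIdx m p i) :
    (P.fullC *ᵥ stackX y) ⟨i, s⟩ = ∑ j ∈ P.nbrN i, (P.blockC i j *ᵥ y j) s := by
  have h : (P.fullC *ᵥ stackX y) ⟨i, s⟩ = ∑ j, (P.blockC i j *ᵥ y j) s := by
    simp only [Matrix.mulVec, dotProduct, Fintype.sum_sigma, fullC, Matrix.of_apply, stackX]
  rw [h]
  refine (Finset.sum_subset (Finset.subset_univ _) fun j _ hj => ?_).symm
  simp [P.blockC_eq_zero hj]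

lemma elim_res (P : Problem n m p) (y : ∀ i, Fin (n i) → ℝ) (i : Fin M) :
    Sum.elim (P.resA y i) (P.resB y i) =
      fun s => (P.fullC *ᵥ stackX y - P.vecC) ⟨i, s⟩ := by
  ext (a | a) <;>
    simp [fullC_mulVec_apply, resA, resB, vecC, blockC, Matrix.fromRows_mulVec]

lemma dotProduct_slope (P : Problem n m p) (ν : DualIdx m p → ℝ) (y : ∀ i, Fin (n i) → ℝ) :
    ∑ i, y i ⬝ᵥ P.slope ν i = ν ⬝ᵥ (P.fullC *ᵥ stackX y) := by
  rw [Matrix.dotProduct_mulVec, ← Matrix.mulVec_transpose, dotProduct_comm]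
  simp only [dotProduct, Fintype.sum_sigma, stackX, slope]

/-! ### The distributed initialization dominates `C H⁻¹ Cᵀ` -/

lemma fullH_inv (P : Problem n m p) (hH : ∀ i, (P.H i).PosDef) :
    P.fullH⁻¹ = Matrix.blockDiagonal' fun i => (P.H i)⁻¹ := by
  refine Matrix.inv_eq_right_inv ?_
  rw [fullH, ← Matrix.blockDiagonal'_mul, ← Matrix.blockDiagonal'_one]
  congr 1
  funext i
  exact Matrix.mul_nonsing_inv _ ((Matrix.isUnit_iff_isUnit_det _).1 (hH i).isUnit)

lemma locC_transpose_mulVec (P : Problem n m p) (ν : DualIdx m p → ℝ) (i : Fin M) :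
    (P.locC i)ᵀ *ᵥ (fun s => ν ⟨s.1.1, s.2⟩) = P.slope ν i := by
  ext a
  rw [slope_apply, ← Finset.sum_coe_sort]
  simp only [Matrix.mulVec, dotProduct, Fintype.sum_sigma, Matrix.transpose_apply, locC,
    Matrix.of_apply]

/-- Double counting of the pairs of neighbours: each block `K j i` enters once, collected either at
the receiving node `i` or at the node `j` that chose it. -/
lemma normSq_initL (P : Problem n m p)
    (K : ∀ _ j : Fin M, Matrix (LocalIdx m p j) (LocalIdx m p j) ℝ) (ν : DualIdx m p → ℝ) :
    normSq (Matrix.blockDiagonal' (P.initL K)) ν =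
      ∑ j, normSq (Matrix.blockDiagonal' fun i : {i // i ∈ P.nbrM j} => K j i.1)
        (fun s => ν ⟨s.1.1, s.2⟩) := by
  simp only [normSq_blockDiagonal']
  have h1 : ∀ i, normSq (P.initL K i) (fun a => ν ⟨i, a⟩) =
      ∑ j ∈ P.nbrN i, normSq (K j i) (fun a => ν ⟨i, a⟩) := by
    intro i
    simp only [normSq, initL, Matrix.sum_mulVec, dotProduct_sum]
  have h2 : ∀ j, ∑ i : {i // i ∈ P.nbrM j}, normSq (K j i.1) (fun a => ν ⟨i.1, a⟩) =
      ∑ i ∈ P.nbrM j, normSq (K j i) (fun a => ν ⟨i, a⟩) :=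
    fun j => Finset.sum_coe_sort (P.nbrM j) fun i => normSq (K j i) (fun a => ν ⟨i, a⟩)
  simp only [h1, h2]
  exact Finset.sum_comm' fun i j => by simp [mem_nbrM_iff]

/-- On a dual vector `ν`, both forms are sums over nodes `j`, and the `j`-th summand sees only the
part of `ν` indexed by `ℳ_j`. The difference is therefore a sum of the local forms `L_{ℳ_j} -
C_{ℳ_j} H_j⁻¹ C_{ℳ_j}ᵀ`. -/
theorem posSemidef_initL_sub (P : Problem n m p) (hH : ∀ i, (P.H i).PosDef)
    {K : ∀ _ j : Fin M, Matrix (LocalIdx m p j) (LocalIdx m p j) ℝ}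
    (hK : ∀ i, Matrix.blockDiagonal' (fun j : {j // j ∈ P.nbrM i} => K i j.1) ∈ P.locSet i) :
    (Matrix.blockDiagonal' (P.initL K) - P.fullC * P.fullH⁻¹ * P.fullCᵀ).PosSemidef := by
  -- The blocks used are symmetric because a block-diagonal matrix determines its blocks, so they
  -- agree with the positive definite ones provided by `locSet`.
  have hKh : ∀ i, ∀ j ∈ P.nbrN i, (K j i).IsHermitian := by
    intro i j hj
    obtain ⟨-, -, K', hK', hKK'⟩ := hK j
    have := congrFun (Matrix.blockDiagonal'_injective hKK') ⟨i, (P.mem_nbrM_iff j i).2 hj⟩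
    simp only at this
    rw [this]
    exact (hK' _).1
  have hL : ∀ i, (P.initL K i).IsHermitian := fun i => by
    rw [Matrix.IsHermitian, initL, Matrix.conjTranspose_sum]
    exact Finset.sum_congr rfl fun j hj => hKh i j hj
  have hinv : P.fullH⁻¹.IsHermitian := (posDef_blockDiagonal' hH).inv.1
  have hC : (P.fullC * P.fullH⁻¹ * P.fullCᵀ).IsHermitian := by
    have := Matrix.isHermitian_mul_mul_conjTranspose P.fullC hinv
    rwa [Matrix.conjTranspose_eq_transpose_of_trivial] at this
  refine .of_dotProduct_mulVec_nonneg ((isHermitian_blockDiagonal' hL).sub hC) fun ν => ?_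
  have h : 0 ≤ normSq (Matrix.blockDiagonal' (P.initL K) - P.fullC * P.fullH⁻¹ * P.fullCᵀ) ν := by
    rw [normSq_sub_matrix, normSq_mul_mul_transpose, normSq_initL, fullH_inv P hH,
      normSq_blockDiagonal', ← Finset.sum_sub_distrib]
    refine Finset.sum_nonneg fun j _ => ?_
    have h1 := normSq_nonneg (hK j).2.1 (fun s => ν ⟨s.1.1, s.2⟩)
    rwa [normSq_sub_matrix, normSq_mul_mul_transpose, locC_transpose_mulVec] at h1
  simpa [normSq] using h

end Problem

/-! ### Finite sums of extended reals -/

section ERealSum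

variable {ι : Type*}

lemma ereal_coe_sum (s : Finset ι) (a : ι → ℝ) :
    ((∑ i ∈ s, a i : ℝ) : EReal) = ∑ i ∈ s, (a i : EReal) := by
  classical
  induction s using Finset.induction_on with
  | empty => simp
  | insert i s hi ih => rw [Finset.sum_insert hi, Finset.sum_insert hi, EReal.coe_add, ih]

lemma ereal_sum_ne_bot {s : Finset ι} {a : ι → EReal} (h : ∀ i ∈ s, a i ≠ ⊥) :
    ∑ i ∈ s, a i ≠ ⊥ := by
  classical
  induction s using Finset.induction_on with
  | empty => simp
  | insert i s hi ih =>
    rw [Finset.sum_insert hi, Ne, EReal.add_eq_bot_iff, not_or]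
    exact ⟨h i (Finset.mem_insert_self i s), ih fun j hj => h j (Finset.mem_insert_of_mem hj)⟩

lemma ereal_sum_eq_top {s : Finset ι} {a : ι → EReal} (h : ∀ i ∈ s, a i ≠ ⊥) {i : ι}
    (hi : i ∈ s) (ht : a i = ⊤) : ∑ i ∈ s, a i = ⊤ := by
  classical
  rw [← Finset.add_sum_erase s a hi, ht]
  exact EReal.top_add_of_ne_bot (ereal_sum_ne_bot fun j hj => h j (Finset.mem_of_mem_erase hj))

lemma ereal_sum_eq_coe {s : Finset ι} {a : ι → EReal} (h : ∀ i ∈ s, a i ≠ ⊥)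
    (h' : ∀ i ∈ s, a i ≠ ⊤) : ∑ i ∈ s, a i = ((∑ i ∈ s, (a i).toReal : ℝ) : EReal) := by
  rw [ereal_coe_sum]
  exact Finset.sum_congr rfl fun i hi => (EReal.coe_toReal (h' i hi) (h i hi)).symm

lemma ereal_iSup_add_le {X : Type*} {u : X → EReal} {c K : EReal} (h : ∀ x, u x + c ≤ K) :
    (⨆ x, u x) + c ≤ K := by
  induction c with
  | bot => simp
  | coe c =>
    rw [← EReal.le_sub_iff_add_le (.inl (EReal.coe_ne_bot c)) (.inl (EReal.coe_ne_top c))]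
    exact iSup_le fun x =>
      (EReal.le_sub_iff_add_le (.inl (EReal.coe_ne_bot c)) (.inl (EReal.coe_ne_top c))).2 (h x)
  -- Here `⊥ + ⊤ = ⊥` matters: either some `u x ≠ ⊥`, forcing `K = ⊤`, or the supremum is `⊥` and
  -- absorbs the `⊤`.
  | top =>
    by_cases hu : ∃ x, u x ≠ ⊥
    · obtain ⟨x, hx⟩ := hu
      have := h x
      rw [EReal.add_top_of_ne_bot hx, top_le_iff] at this
      rw [this]
      exact le_top
    · simp only [ne_eq, not_exists, not_not] at hu
      simp [hu]

/-- A sum of suprema over independent variables is bounded by any bound of the sums. -/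
lemma ereal_sum_iSup_add_le [DecidableEq ι] {X : ι → Type*} [∀ i, Nonempty (X i)]
    {u : ∀ i, X i → EReal} {K : EReal} (s : Finset ι) (r : EReal)
    (h : ∀ x : ∀ i, X i, ∑ i ∈ s, u i (x i) + r ≤ K) : ∑ i ∈ s, (⨆ x, u i x) + r ≤ K := by
  -- The remainder `r` varies so that, once the variable of the new index is fixed, its term can be
  -- moved into `r`.
  induction s using Finset.induction_on generalizing r with
  | empty => simpa using h fun _ => Classical.arbitrary _
  | insert i s hi ih =>
    rw [Finset.sum_insert hi, add_assoc]
    refine ereal_iSup_add_le fun x => ?_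
    rw [add_left_comm]
    refine ih _ fun z => ?_
    have := h (Function.update z i x)
    rw [Finset.sum_insert hi, Function.update_self,
      Finset.sum_congr rfl fun j hj => by
        rw [Function.update_of_ne (ne_of_mem_of_not_mem hj hi)]] at this
    rwa [add_left_comm, ← add_assoc]

end ERealSum

namespace Problem

variable {M : ℕ} {n m p : Fin M → ℕ} {P : Problem n m p}

/-! ### The smooth part of the dual objective -/

/-- The real value of `F` at a point of its domain. -/
def primalVal (P : Problem n m p) (y : ∀ i, Fin (n i) → ℝ) : ℝ :=
  ∑ i, (P.f i (y i) + (P.h i (y i)).toReal)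

/-- `y` minimizes the Lagrangian at `ν`, node by node. -/
def IsPrimalMin (P : Problem n m p) (ν : DualIdx m p → ℝ) (y : ∀ i, Fin (n i) → ℝ) : Prop :=
  ∀ i, IsArgmin
    (fun x => P.h i x + ((P.f i x + x ⬝ᵥ P.slope ν i : ℝ) : EReal)) (y i)

lemma exists_isPrimalMin (hP : P.Assumptions) (ν : DualIdx m p → ℝ) :
    ∃ y, P.IsPrimalMin ν y := by
  have : ∀ i, ∃ x, IsArgmin
      (fun x => P.h i x + ((P.f i x + x ⬝ᵥ P.slope ν i : ℝ) : EReal)) x := by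
    intro i
    have hs := hP.strong i
    refine exists_isArgmin_add (hP.h_proper i) (hP.h_closed i)
      (exists_affine_minorant (hP.h_proper i) (hP.h_closed i) (hP.h_convex i))
      (hs.2.1.continuous.add (by fun_prop)) hs.1 (c' := P.f i 0)
      (ℓ' := fderiv ℝ (P.f i) 0 + dotRight (P.slope ν i)) fun x => ?_
    have h1 := hs.2.2 x 0
    simp only [sub_zero] at h1
    simp only [add_apply, dotRight_apply]
    linarith
  choose y hy using this
  exact ⟨y, hy⟩

lemma IsPrimalMin.h_ne_top (hP : P.Assumptions) {ν : DualIdx m p → ℝ}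
    {y : ∀ i, Fin (n i) → ℝ} (hy : P.IsPrimalMin ν y) (i : Fin M) : P.h i (y i) ≠ ⊤ :=
  (hy i).ne_top (hP.h_proper i)

/-- Quadratic growth of the Lagrangian at its minimizer. -/
lemma IsPrimalMin.growth (hP : P.Assumptions) {ν : DualIdx m p → ℝ}
    {y : ∀ i, Fin (n i) → ℝ} (hy : P.IsPrimalMin ν y) {x : ∀ i, Fin (n i) → ℝ}
    (hx : ∀ i, P.h i (x i) ≠ ⊤) :
    P.primalVal y + ν ⬝ᵥ (P.fullC *ᵥ stackX y) + 1 / 2 * normSq P.fullH (stackX x - stackX y) ≤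
      P.primalVal x + ν ⬝ᵥ (P.fullC *ᵥ stackX x) := by
  have hN : normSq P.fullH (stackX x - stackX y) = ∑ i, normSq (P.H i) (x i - y i) := by
    rw [fullH, normSq_blockDiagonal']
    rfl
  rw [hN, primalVal, primalVal, ← dotProduct_slope, ← dotProduct_slope, Finset.mul_sum,
    ← Finset.sum_add_distrib, ← Finset.sum_add_distrib, ← Finset.sum_add_distrib]
  refine Finset.sum_le_sum fun i _ => ?_
  have := (hy i).add_half_normSq_le (x := x i) (hP.h_convex i)
    (q := fun x => P.f i x + x ⬝ᵥ P.slope ν i)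
    (fun x y t => (hP.strong i).segment_le (P.slope ν i) x y t)
    ((hP.h_proper i).coe_toReal (hy.h_ne_top hP i)).symm
    ((hP.h_proper i).coe_toReal (hx i)).symm
  linarith

lemma sumF_eq_coe (hP : P.Assumptions) {x : ∀ i, Fin (n i) → ℝ}
    (hx : ∀ i, P.h i (x i) ≠ ⊤) : P.sumF (stackX x) = (P.primalVal x : EReal) := by
  rw [primalVal, ereal_coe_sum]
  refine Finset.sum_congr rfl fun i _ => ?_
  rw [EReal.coe_add, (hP.h_proper i).coe_toReal (hx i)]
  rfl

lemma sumF_eq_top (hP : P.Assumptions) {x : ∀ i, Fin (n i) → ℝ} {i : Fin M}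
    (hx : P.h i (x i) = ⊤) : P.sumF (stackX x) = ⊤ := by
  refine ereal_sum_eq_top (fun j _ => ?_) (Finset.mem_univ i) ?_
  · rw [Ne, EReal.add_eq_bot_iff, not_or]
    exact ⟨EReal.coe_ne_bot _, (hP.h_proper j).1 _⟩
  · change (P.f i (x i) : EReal) + P.h i (x i) = ⊤
    rw [hx]
    exact EReal.coe_add_top _

/-- The real value of the smooth part of the dual objective, in terms of a minimizer of the
Lagrangian. -/
def dualVal (P : Problem n m p) (ν : DualIdx m p → ℝ) (y : ∀ i, Fin (n i) → ℝ) : ℝ :=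
  P.primalVal y + ν ⬝ᵥ (P.fullC *ᵥ stackX y - P.vecC)

/-- The supremum defining `F⋆(-Cᵀν)` is attained at `y`: growth of the Lagrangian bounds every other
term, and points outside the domain of some `h_i` contribute `⊥`. -/
lemma IsPrimalMin.d_eq (hP : P.Assumptions) {ν : DualIdx m p → ℝ}
    {y : ∀ i, Fin (n i) → ℝ} (hy : P.IsPrimalMin ν y) : P.d ν = (P.dualVal ν y : EReal) := by
  have hneg : ∀ x : ∀ i, Fin (n i) → ℝ,
      -(P.fullCᵀ *ᵥ ν) ⬝ᵥ stackX x = -(ν ⬝ᵥ (P.fullC *ᵥ stackX x)) := by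
    intro x
    rw [neg_dotProduct, Matrix.mulVec_transpose, ← Matrix.dotProduct_mulVec]
  have hconj : conj P.sumF (-(P.fullCᵀ *ᵥ ν)) =
      ((-(P.primalVal y + ν ⬝ᵥ (P.fullC *ᵥ stackX y)) : ℝ) : EReal) := by
    refine le_antisymm (iSup_le fun X => ?_) ?_
    · obtain ⟨x, rfl⟩ : ∃ x : ∀ i, Fin (n i) → ℝ, X = stackX x := ⟨fun i a => X ⟨i, a⟩, rfl⟩
      by_cases hx : ∀ i, P.h i (x i) ≠ ⊤
      · rw [sumF_eq_coe hP hx, ← EReal.coe_sub, EReal.coe_le_coe_iff, hneg]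
        have h0 := normSq_nonneg (posDef_blockDiagonal' fun i => (hP.strong i).1).posSemidef
          (stackX x - stackX y)
        have := hy.growth hP hx
        rw [fullH] at this
        linarith
      · simp only [ne_eq, not_forall, not_not] at hx
        obtain ⟨i, hi⟩ := hx
        simp [sumF_eq_top hP hi]
    · refine le_trans (le_of_eq ?_) (le_conj P.sumF _ (stackX y))
      rw [sumF_eq_coe hP (hy.h_ne_top hP), ← EReal.coe_sub, EReal.coe_eq_coe_iff, hneg]
      ring
  rw [d, hconj, ← EReal.coe_neg, ← EReal.coe_sub, EReal.coe_eq_coe_iff, dualVal,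
    dotProduct_sub, dotProduct_comm P.vecC]
  ring

/-- The minimizer `y` for `ν` is a competitor in the Lagrangian at `ν'`, which is affine in the
multiplier. -/
lemma IsPrimalMin.dualVal_le (hP : P.Assumptions) {ν ν' : DualIdx m p → ℝ}
    {y y' : ∀ i, Fin (n i) → ℝ} (hy : P.IsPrimalMin ν y) (hy' : P.IsPrimalMin ν' y') :
    P.dualVal ν' y' ≤ P.dualVal ν y + (ν' - ν) ⬝ᵥ (P.fullC *ᵥ stackX y - P.vecC) := by
  have h0 := normSq_nonneg (posDef_blockDiagonal' fun i => (hP.strong i).1).posSemidef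
    (stackX y - stackX y')
  have := hy'.growth hP (hy.h_ne_top hP)
  rw [fullH] at this
  simp only [dualVal, dotProduct_sub, sub_dotProduct]
  linarith

/-- The quadratic lower bound of the smooth part of the dual objective in the metric `L`. -/
lemma IsPrimalMin.le_dualVal (hP : P.Assumptions)
    {L : Matrix (DualIdx m p) (DualIdx m p) ℝ}
    (hL : (L - P.fullC * P.fullH⁻¹ * P.fullCᵀ).PosSemidef) {ν ν' : DualIdx m p → ℝ}
    {y y' : ∀ i, Fin (n i) → ℝ} (hy : P.IsPrimalMin ν y) (hy' : P.IsPrimalMin ν' y') :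
    P.dualVal ν y + (ν' - ν) ⬝ᵥ (P.fullC *ᵥ stackX y - P.vecC) - 1 / 2 * normSq L (ν' - ν) ≤
      P.dualVal ν' y' := by
  have h1 := hy.growth hP (hy'.h_ne_top hP)
  -- Changing the multiplier in the Lagrangian at `y'` leaves the cross term `(ν' - ν)ᵀ C (y' - y)`.
  -- Young's inequality pays for it with the growth term of `h1`, at cost `½‖Cᵀ(ν' - ν)‖²` in the
  -- metric `H⁻¹`, which `L` dominates.
  have h2 := neg_half_normSq_inv_le (H := P.fullH)
    (posDef_blockDiagonal' fun i => (hP.strong i).1) (stackX y' - stackX y)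
    (P.fullCᵀ *ᵥ (ν' - ν))
  have h3 := normSq_nonneg hL (ν' - ν)
  rw [normSq_sub_matrix, normSq_mul_mul_transpose, Matrix.mulVec_transpose] at h3
  rw [dotProduct_comm, Matrix.mulVec_transpose, ← Matrix.dotProduct_mulVec, Matrix.mulVec_sub,
    dotProduct_sub, sub_dotProduct, sub_dotProduct] at h2
  simp only [dualVal, dotProduct_sub, sub_dotProduct]
  linarith

/-! ### The non-smooth part of the dual objective -/

/-- The component `μ_i` of a dual vector. -/
def muPart (ν : DualIdx m p → ℝ) (i : Fin M) : Fin (p i) → ℝ := fun a => ν ⟨i, Sum.inr a⟩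

/-- The real value of `g⋆(μ)` on its domain. -/
def conjVal (P : Problem n m p) (ν : DualIdx m p → ℝ) : ℝ :=
  ∑ i, (conj (P.g i) (muPart ν i)).toReal

/-- The blocks of the variable are independent, so the supremum of the sum is the sum of the
suprema; `hterm` is the care needed for infinite values. -/
lemma conj_sumG (hP : P.Assumptions) (ν : DualIdx m p → ℝ) :
    conj P.sumG (fun s => ν ⟨s.1, Sum.inr s.2⟩) = ∑ i, conj (P.g i) (muPart ν i) := by
  have hterm : ∀ x : ∀ i, Fin (p i) → ℝ,
      (((fun s : Σ i, Fin (p i) => ν ⟨s.1, Sum.inr s.2⟩) ⬝ᵥ (fun s => x s.1 s.2) : ℝ) : EReal) -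
        P.sumG (fun s => x s.1 s.2) =
      ∑ i, (((muPart ν i ⬝ᵥ x i : ℝ) : EReal) - P.g i (x i)) := by
    intro x
    by_cases hx : ∀ i, P.g i (x i) ≠ ⊤
    · have h1 : P.sumG (fun s => x s.1 s.2) =
          ((∑ i, (P.g i (x i)).toReal : ℝ) : EReal) :=
        ereal_sum_eq_coe (fun i _ => (hP.g_proper i).1 _) fun i _ => hx i
      have h2 : ∀ i, (((muPart ν i ⬝ᵥ x i : ℝ) : EReal) - P.g i (x i)) =
          ((muPart ν i ⬝ᵥ x i - (P.g i (x i)).toReal : ℝ) : EReal) := fun i => by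
        rw [EReal.coe_sub, (hP.g_proper i).coe_toReal (hx i)]
      simp only [h1, h2]
      rw [← EReal.coe_sub, ← ereal_coe_sum, Finset.sum_sub_distrib, EReal.coe_eq_coe_iff]
      simp only [dotProduct, Fintype.sum_sigma, muPart]
    · simp only [ne_eq, not_forall, not_not] at hx
      obtain ⟨i, hi⟩ := hx
      have h1 : P.sumG (fun s => x s.1 s.2) = ⊤ :=
        ereal_sum_eq_top (fun j _ => (hP.g_proper j).1 _) (Finset.mem_univ i) hi
      rw [h1, ← Finset.add_sum_erase _ _ (Finset.mem_univ i), hi]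
      simp
  refine le_antisymm (iSup_le fun X => ?_) ?_
  · have := hterm fun i a => X ⟨i, a⟩
    refine le_trans (le_of_eq this) (Finset.sum_le_sum fun i _ => le_conj _ _ _)
  · have := ereal_sum_iSup_add_le (X := fun i : Fin M => Fin (p i) → ℝ)
      (u := fun i x => ((muPart ν i ⬝ᵥ x : ℝ) : EReal) - P.g i x)
      (K := conj P.sumG (fun s => ν ⟨s.1, Sum.inr s.2⟩)) Finset.univ 0 fun x => by
        rw [add_zero, ← hterm]
        exact le_conj _ _ _
    rwa [add_zero] at this

lemma IsPrimalMin.D_eq (hP : P.Assumptions) {ν : DualIdx m p → ℝ}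
    {y : ∀ i, Fin (n i) → ℝ} (hy : P.IsPrimalMin ν y)
    (hν : ∀ i, conj (P.g i) (muPart ν i) ≠ ⊤) :
    P.D ν = ((P.dualVal ν y - P.conjVal ν : ℝ) : EReal) := by
  rw [D, hy.d_eq hP, conj_sumG hP,
    ereal_sum_eq_coe (fun i _ => (hP.g_proper i).conj_ne_bot _) fun i _ => hν i, ← EReal.coe_sub]
  rfl

lemma conj_ne_top_of_D_ne_bot (hP : P.Assumptions) {ν : DualIdx m p → ℝ} (h : P.D ν ≠ ⊥)
    (i : Fin M) : conj (P.g i) (muPart ν i) ≠ ⊤ := by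
  intro hi
  apply h
  rw [D, conj_sumG hP,
    ereal_sum_eq_top (fun j _ => (hP.g_proper j).conj_ne_bot _) (Finset.mem_univ i) hi]
  simp

/-- Each `g_i⋆` is proper, so `D` is finite at some point; a maximizer cannot then have value `⊥`.
-/
lemma conj_ne_top_of_isMaxOn (hP : P.Assumptions) {νs : DualIdx m p → ℝ}
    (hs : IsMaxOn P.D Set.univ νs) (i : Fin M) : conj (P.g i) (muPart νs i) ≠ ⊤ := by
  have : ∀ i, ∃ v, conj (P.g i) v ≠ ⊤ := fun i =>
    ((hP.g_proper i).conj (hP.g_closed i) (hP.g_convex i)).2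
  choose v hv using this
  set ν : DualIdx m p → ℝ := stack 0 v
  obtain ⟨y, hy⟩ := exists_isPrimalMin hP ν
  refine conj_ne_top_of_D_ne_bot hP (fun hbot => ?_) i
  have h1 : P.D ν ≤ P.D νs := hs (Set.mem_univ ν)
  rw [hbot, le_bot_iff, hy.D_eq hP hv] at h1
  exact EReal.coe_ne_bot _ h1

end Problem

/-! ### The proximal step -/

section Prox

variable {κ : Type*} [Fintype κ] {ψ : (κ → ℝ) → EReal} {L : Matrix κ κ ℝ}

lemma exists_isProx (hp : Proper ψ) (hl : LowerSemicontinuous ψ)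
    (hm : ∃ (ℓ : (κ → ℝ) →L[ℝ] ℝ) (c : ℝ), ∀ x, ((c + ℓ x : ℝ) : EReal) ≤ ψ x)
    (hL : L.PosDef) (u : κ → ℝ) : ∃ x, IsProx ψ L u x := by
  have hq : Continuous fun x => 1 / 2 * normSq L (x - u) :=
    continuous_const.mul ((continuous_normSq L).comp (by fun_prop))
  refine exists_isArgmin_add hp hl hm hq hL (c' := 1 / 2 * normSq L u)
    (ℓ' := -dotRight (L *ᵥ u)) fun x => ?_
  rw [normSq_sub hL.1, neg_apply, dotRight_apply]
  linarith

/-- The inequality satisfied by a proximal gradient step. -/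
lemma IsProx.three_point [DecidableEq κ] (hc : ConvexFun ψ) (hL : L.PosDef)
    {z r x w : κ → ℝ} (h : IsProx ψ L (z + L⁻¹ *ᵥ r) x) {a b : ℝ} (hx : ψ x = a)
    (hw : ψ w = b) :
    a + 1 / 2 * normSq L (x - z) - (x - z) ⬝ᵥ r + 1 / 2 * normSq L (w - x) ≤
      b + 1 / 2 * normSq L (w - z) - (w - z) ⬝ᵥ r := by
  have h1 := IsArgmin.add_half_normSq_le hc
    (q := fun x => 1 / 2 * normSq L (x - (z + L⁻¹ *ᵥ r)))
    (fun x y t _ _ => (half_normSq_segment hL.1 _ x y t).le) h hx hw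
  have hLr : L *ᵥ (L⁻¹ *ᵥ r) = r := by
    rw [Matrix.mulVec_mulVec,
      Matrix.mul_nonsing_inv _ ((Matrix.isUnit_iff_isUnit_det _).1 hL.isUnit), Matrix.one_mulVec]
  -- Completing the square: `½‖x - z - L⁻¹r‖²` is `½‖x - z‖² - (x - z)ᵀr` plus a constant that
  -- cancels between the two sides.
  simp only [← sub_sub] at h1
  rw [normSq_sub hL.1 (x - z), normSq_sub hL.1 (w - z), hLr] at h1
  linarith

lemma normSq_fromBlocks {τ : Type*} [Fintype τ] (L : Matrix κ κ ℝ) (K : Matrix τ τ ℝ)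
    (x : κ → ℝ) (y : τ → ℝ) :
    normSq (Matrix.fromBlocks L 0 0 K) (Sum.elim x y) = normSq L x + normSq K y := by
  simp [normSq, Matrix.fromBlocks_mulVec, dotProduct]

/-- The joint proximal step with a block diagonal matrix splits into separate steps. -/
lemma isProx_fromBlocks_iff {τ : Type*} [Fintype τ] {K : Matrix τ τ ℝ} (hp : Proper ψ)
    (hK : K.PosDef) (a l : τ → ℝ) (b u : κ → ℝ) :
    IsProx (fun w : τ ⊕ κ → ℝ => ψ fun i => w (Sum.inr i)) (Matrix.fromBlocks K 0 0 L)
      (Sum.elim a b) (Sum.elim l u) ↔ l = a ∧ IsProx ψ L b u := by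
  have hval : ∀ (l' : τ → ℝ) (u' : κ → ℝ),
      normSq (Matrix.fromBlocks K 0 0 L) (Sum.elim l' u' - Sum.elim a b) =
        normSq K (l' - a) + normSq L (u' - b) := by
    intro l' u'
    rw [← normSq_fromBlocks]
    congr 1
    ext (i | i) <;> simp
  constructor
  · intro h
    -- Finiteness allows `ψ u` to be cancelled when `(l, u)` is compared with `(a, u)`.
    have hfin : ψ u ≠ ⊤ := by
      obtain ⟨w, hw⟩ := hp.2
      intro hu
      have h1 := h.le (Sum.elim a w)
      simp only [Sum.elim_inr, hu, EReal.top_add_coe, top_le_iff] at h1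
      rw [← hp.coe_toReal hw, ← EReal.coe_add] at h1
      exact EReal.coe_ne_top _ h1
    have hla : l = a := by
      by_contra hne
      have h1 := h.le (Sum.elim a u)
      simp only [Sum.elim_inr, hval] at h1
      rw [← hp.coe_toReal hfin, ← EReal.coe_add, ← EReal.coe_add, EReal.coe_le_coe_iff] at h1
      have h2 : 0 < normSq K (l - a) := by
        simpa [normSq] using hK.dotProduct_mulVec_pos (sub_ne_zero.2 hne)
      have h3 : normSq K (a - a) = 0 := by simp [normSq]
      linarith
    subst hla
    refine ⟨rfl, fun w _ => ?_⟩
    have h1 := h.le (Sum.elim l w)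
    have h3 : normSq K (l - l) = 0 := by simp [normSq]
    simp only [Sum.elim_inr, hval, h3, zero_add] at h1
    exact h1
  · rintro ⟨rfl, h⟩ w _
    obtain ⟨l', u', rfl⟩ : ∃ l' u', w = Sum.elim l' u' :=
      ⟨_, _, (Sum.elim_comp_inl_inr w).symm⟩
    have h3 : normSq K (l - l) = 0 := by simp [normSq]
    simp only [Set.mem_ofPred_eq, Sum.elim_inr, hval, h3, zero_add]
    refine (h.le u').trans (add_le_add_right ?_ _)
    rw [EReal.coe_le_coe_iff]
    have := normSq_nonneg hK.posSemidef (l' - l)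
    linarith

end Prox

/-! ### Accelerated convergence -/

section Acceleration

variable {κ : Type*} [Fintype κ] {L : Matrix κ κ ℝ}

/-- Its coefficients dictate the weights in `accelerated_rate`: `T(T-1)` for the comparison with the
previous iterate and `T` for the one with the solution. -/
lemma normSq_extrapolation (hL : L.IsHermitian) (a z s : κ → ℝ) (T : ℝ) :
    normSq L (T • z - (T - 1) • a - s) =
      T * (T - 1) * normSq L (a - z) + T * normSq L (s - z) - (T - 1) * normSq L (s - a) := by
  have e1 : T • z - (T - 1) • a - s = (T - 1) • (s - a) - T • (s - z) := by module
  have e2 : a - z = (s - z) - (s - a) := by abel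
  rw [e1, e2, normSq_sub hL, normSq_sub hL, normSq_smul, normSq_smul,
    dotProduct_mulVec_comm hL (s - z)]
  simp only [Matrix.mulVec_smul, smul_dotProduct, dotProduct_smul, smul_eq_mul]
  ring

/-- The `O(1/k²)` rate of an accelerated scheme, derived from the descent inequalities of its
steps. -/
lemma accelerated_rate (hL : L.PosSemidef) {x z : ℕ → κ → ℝ} {t ψ : ℕ → ℝ} {s : κ → ℝ} {ψs : ℝ}
    (ht1 : t 1 = 1) (ht : ∀ k, 1 ≤ k → t (k + 1) = (1 + √(1 + 4 * t k ^ 2)) / 2)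
    (hz1 : z 1 = x 0)
    (hz : ∀ k, 1 ≤ k → z (k + 1) = x k + ((t k - 1) / t (k + 1)) • (x k - x (k - 1)))
    (h1 : ∀ k, 1 ≤ k → ψ k ≤ ψs + 1 / 2 * normSq L (s - z k) - 1 / 2 * normSq L (s - x k))
    (h2 : ∀ k, 1 ≤ k → ψ (k + 1) ≤
      ψ k + 1 / 2 * normSq L (x k - z (k + 1)) - 1 / 2 * normSq L (x k - x (k + 1)))
    (hs : ∀ k, 1 ≤ k → ψs ≤ ψ k) {k : ℕ} (hk : 1 ≤ k) :
    ψ k - ψs ≤ 2 * normSq L (s - x 0) / ((k : ℝ) + 1) ^ 2 := by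
  have htk : ∀ k : ℕ, 1 ≤ k → ((k : ℝ) + 1) / 2 ≤ t k := by
    intro k hk
    induction k, hk using Nat.le_induction with
    | base => rw [ht1]; norm_num
    | succ k hk ih =>
      rw [ht k hk]
      have hk0 : (0 : ℝ) ≤ k := k.cast_nonneg
      have : 2 * t k ≤ √(1 + 4 * t k ^ 2) := Real.le_sqrt_of_sq_le (by nlinarith)
      push_cast
      linarith
  -- The potential never exceeds its initial bound. At `k = 1` the coefficient `t 1 - 1` vanishes
  -- and only `h1` is used, so no objective value at `x 0`, possibly infinite in the application, is
  -- needed.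
  have hinv : ∀ k, 1 ≤ k → t k ^ 2 * (ψ k - ψs) +
      1 / 2 * normSq L (t k • x k - (t k - 1) • x (k - 1) - s) ≤ 1 / 2 * normSq L (s - x 0) := by
    intro k hk
    induction k, hk using Nat.le_induction with
    | base =>
      have h := h1 1 le_rfl
      rw [hz1] at h
      rw [normSq_extrapolation hL.1, ht1]
      linarith
    | succ k hk ih =>
      have hT1 : 1 ≤ t (k + 1) := by
        have h := htk (k + 1) (by omega)
        have : (1 : ℝ) ≤ k := by exact_mod_cast hk
        push_cast at h
        linarith
      have hT : t (k + 1) * (t (k + 1) - 1) = t k ^ 2 := by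
        rw [ht k hk]
        have := Real.sq_sqrt (show 0 ≤ 1 + 4 * t k ^ 2 by positivity)
        linarith
      -- The extrapolation rule is designed for this identity: the point in the potential at `k` can
      -- be rewritten through `z (k + 1)`.
      have hzx : t k • x k - (t k - 1) • x (k - 1) - s =
          t (k + 1) • z (k + 1) - (t (k + 1) - 1) • x k - s := by
        rw [hz k hk, smul_add, smul_smul, mul_div_cancel₀ _ (by linarith)]
        module
      rw [hzx, normSq_extrapolation hL.1] at ih
      rw [normSq_extrapolation hL.1, Nat.add_sub_cancel]
      have ha := mul_le_mul_of_nonneg_left (h2 k hk)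
        (mul_nonneg (by linarith : 0 ≤ t (k + 1)) (sub_nonneg.2 hT1))
      have hb := mul_le_mul_of_nonneg_left (h1 (k + 1) (by omega))
        (by linarith : 0 ≤ t (k + 1))
      rw [← hT] at ih
      linarith
  have h := hinv k hk
  have h0 := normSq_nonneg hL (t k • x k - (t k - 1) • x (k - 1) - s)
  have hk0 : (0 : ℝ) < (k : ℝ) + 1 := by positivity
  have hsq : (((k : ℝ) + 1) / 2) ^ 2 ≤ t k ^ 2 := pow_le_pow_left₀ (by positivity) (htk k hk) 2
  have hmul := mul_le_mul_of_nonneg_right hsq (sub_nonneg.2 (hs k hk))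
  rw [le_div_iff₀ (by positivity)]
  linarith

end Acceleration

namespace Problem

variable {M : ℕ} {n m p : Fin M → ℕ} {P : Problem n m p}

/-- The function `(λ_i, μ_i) ↦ g_i⋆(μ_i)`. -/
def conjG (P : Problem n m p) (i : Fin M) (w : LocalIdx m p i → ℝ) : EReal :=
  conj (P.g i) fun a => w (Sum.inr a)

lemma conjG_proper (hP : P.Assumptions) (i : Fin M) : Proper (P.conjG i) := by
  have h := (hP.g_proper i).conj (hP.g_closed i) (hP.g_convex i)
  refine ⟨fun w => h.1 _, ?_⟩
  obtain ⟨v, hv⟩ := h.2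
  exact ⟨Sum.elim 0 v, hv⟩

lemma conjG_convex (hP : P.Assumptions) (i : Fin M) : ConvexFun (P.conjG i) :=
  fun q hq q' hq' _ _ ha hb hab =>
    (hP.g_proper i).convexFun_conj (x := (fun a => q.1 (Sum.inr a), q.2)) hq
      (y := (fun a => q'.1 (Sum.inr a), q'.2)) hq' ha hb hab

lemma exists_isProx_conjG (hP : P.Assumptions) (i : Fin M)
    {L : Matrix (LocalIdx m p i) (LocalIdx m p i) ℝ} (hL : L.PosDef)
    (u : LocalIdx m p i → ℝ) : ∃ x, IsProx (P.conjG i) L u x := by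
  refine exists_isProx (conjG_proper hP i)
    ((hP.g_proper i).lowerSemicontinuous_conj.comp (by fun_prop)) ?_ hL u
  obtain ⟨ℓ, c, h⟩ := (hP.g_proper i).exists_affine_minorant_conj
  exact ⟨ℓ.comp (ContinuousLinearMap.pi fun a => ContinuousLinearMap.proj (Sum.inr a)), c,
    fun w => h fun a => w (Sum.inr a)⟩

lemma isPrimalMin_stack_iff (lam : ∀ i, Fin (m i) → ℝ) (mu : ∀ i, Fin (p i) → ℝ)
    (y : ∀ i, Fin (n i) → ℝ) :
    P.IsPrimalMin (stack lam mu) y ↔ ∀ i,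
      IsArgmin (fun x : Fin (n i) → ℝ => (P.f i x : EReal) + P.h i x +
      ((x ⬝ᵥ ((∑ j ∈ P.nbrM i, (P.A j i)ᵀ *ᵥ lam j) +
        (∑ j ∈ P.nbrM i, (P.B j i)ᵀ *ᵥ mu j)) : ℝ) : EReal)) (y i) := by
  refine forall_congr' fun i => ?_
  rw [slope_stack]
  refine iff_of_eq (congrArg (IsArgmin · (y i)) (funext fun x => ?_))
  rw [EReal.coe_add, ← add_assoc, add_comm (P.h i x)]

/-- The inequality satisfied by one joint step of the method, between dual values. -/
lemma dual_step_inequality (hP : P.Assumptions)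
    {L : ∀ i, Matrix (LocalIdx m p i) (LocalIdx m p i) ℝ} (hL : ∀ i, (L i).PosDef)
    (hLC : (Matrix.blockDiagonal' L - P.fullC * P.fullH⁻¹ * P.fullCᵀ).PosSemidef)
    {z x w : DualIdx m p → ℝ} {y yx yw : ∀ i, Fin (n i) → ℝ}
    (hy : P.IsPrimalMin z y) (hyx : P.IsPrimalMin x yx) (hyw : P.IsPrimalMin w yw)
    (hx : ∀ i, IsProx (P.conjG i) (L i)
      ((fun s => z ⟨i, s⟩) + (L i)⁻¹ *ᵥ fun s => (P.fullC *ᵥ stackX y - P.vecC) ⟨i, s⟩)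
      fun s => x ⟨i, s⟩)
    (hw : ∀ i, conj (P.g i) (muPart w i) ≠ ⊤) :
    P.conjVal x - P.dualVal x yx ≤ P.conjVal w - P.dualVal w yw +
      1 / 2 * normSq (Matrix.blockDiagonal' L) (w - z) -
      1 / 2 * normSq (Matrix.blockDiagonal' L) (w - x) := by
  set r := P.fullC *ᵥ stackX y - P.vecC with hr
  have h1 := hy.le_dualVal hP hLC hyx
  have h2 := hy.dualVal_le hP hyw
  -- The prox steps are summed over the nodes. Adding `h1` and `h2` cancels `½‖x - z‖²` and the
  -- pairings with `r`.
  have h3 : P.conjVal x + 1 / 2 * normSq (Matrix.blockDiagonal' L) (x - z) - (x - z) ⬝ᵥ r +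
      1 / 2 * normSq (Matrix.blockDiagonal' L) (w - x) ≤
      P.conjVal w + 1 / 2 * normSq (Matrix.blockDiagonal' L) (w - z) - (w - z) ⬝ᵥ r := by
    have hdot : ∀ u : DualIdx m p → ℝ,
        u ⬝ᵥ r = ∑ i, (fun s => u ⟨i, s⟩) ⬝ᵥ fun s => r ⟨i, s⟩ := fun u => by
      simp only [dotProduct, Fintype.sum_sigma]
    simp only [normSq_blockDiagonal', hdot, conjVal, Finset.mul_sum,
      ← Finset.sum_add_distrib, ← Finset.sum_sub_distrib]
    refine Finset.sum_le_sum fun i _ => ?_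
    have hxt : P.conjG i (fun s => x ⟨i, s⟩) ≠ ⊤ := (hx i).ne_top (conjG_proper hP i)
    exact (hx i).three_point (conjG_convex hP i) (hL i) (w := fun s => w ⟨i, s⟩)
      ((conjG_proper hP i).coe_toReal hxt).symm
      ((conjG_proper hP i).coe_toReal (x := fun s => w ⟨i, s⟩) (hw i)).symm
  linarith

lemma IsJointRun.hasRate (hP : P.Assumptions)
    {L : ∀ i, Matrix (LocalIdx m p i) (LocalIdx m p i) ℝ} (hL : ∀ i, (L i).PosDef)
    (hLC : (Matrix.blockDiagonal' L - P.fullC * P.fullH⁻¹ * P.fullCᵀ).PosSemidef)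
    {lam0 : ∀ i, Fin (m i) → ℝ} {mu0 : ∀ i, Fin (p i) → ℝ} {S : Iterates n m p}
    (hS : P.IsJointRun L lam0 mu0 S) : P.HasRate L S := by
  intro νs hmax k hk
  set x : ℕ → DualIdx m p → ℝ := fun k => stack (S.lam k) (S.mu k) with hx
  set z : ℕ → DualIdx m p → ℝ := fun k => stack (S.z k) (S.v k) with hz
  -- The run supplies Lagrangian minimizers only at the points `z k`; evaluating `D` at the iterates
  -- and at `νs` requires minimizers there too.
  choose Y hY using exists_isPrimalMin hP
  have hlocal : ∀ (lam : ∀ i, Fin (m i) → ℝ) (mu : ∀ i, Fin (p i) → ℝ) (i : Fin M),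
      (fun s => stack lam mu ⟨i, s⟩) = Sum.elim (lam i) (mu i) := fun _ _ _ => rfl
  have hy : ∀ k, 1 ≤ k → P.IsPrimalMin (z k) (S.y k) := fun k hk =>
    (isPrimalMin_stack_iff _ _ _).2 (hS.y_step k hk)
  have hprox : ∀ k, 1 ≤ k → ∀ i, IsProx (P.conjG i) (L i)
      ((fun s => z k ⟨i, s⟩) +
        (L i)⁻¹ *ᵥ fun s => (P.fullC *ᵥ stackX (S.y k) - P.vecC) ⟨i, s⟩)
      fun s => x k ⟨i, s⟩ := by
    intro k hk i
    rw [← elim_res]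
    exact hS.dual_step k hk i
  have hfin : ∀ k, 1 ≤ k → ∀ i, conj (P.g i) (muPart (x k) i) ≠ ⊤ := fun k hk i =>
    (hprox k hk i).ne_top (conjG_proper hP i)
  have hsfin := conj_ne_top_of_isMaxOn hP hmax
  have hDs := (hY νs).D_eq hP hsfin
  have hDx : ∀ k, 1 ≤ k → P.D (x k) = _ := fun k hk => (hY (x k)).D_eq hP (hfin k hk)
  have hmaxk : ∀ k, 1 ≤ k → P.conjVal νs - P.dualVal νs (Y νs) ≤
      P.conjVal (x k) - P.dualVal (x k) (Y (x k)) := by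
    intro k hk
    have h1 : P.D (x k) ≤ P.D νs := hmax (Set.mem_univ _)
    rw [hDs, hDx k hk, EReal.coe_le_coe_iff] at h1
    linarith
  have hz1 : z 1 = x 0 := by
    simp only [hz, hx, hS.z_init, hS.v_init, hS.lam_init, hS.mu_init]
  have hzs : ∀ k, 1 ≤ k →
      z (k + 1) = x k + ((S.t k - 1) / S.t (k + 1)) • (x k - x (k - 1)) := by
    intro k hk
    ext ⟨i, a | a⟩
    · simpa [hz, hx, stack] using congrFun (hS.z_step k hk i) a
    · simpa [hz, hx, stack] using congrFun (hS.v_step k hk i) a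
  have hrate := accelerated_rate (posDef_blockDiagonal' hL).posSemidef (s := νs)
    (ψ := fun k => P.conjVal (x k) - P.dualVal (x k) (Y (x k)))
    (ψs := P.conjVal νs - P.dualVal νs (Y νs)) hS.t_init hS.t_step hz1 hzs
    (fun k hk => dual_step_inequality hP hL hLC (hy k hk) (hY _) (hY _) (hprox k hk) hsfin)
    (fun k hk => dual_step_inequality hP hL hLC (hy (k + 1) (by omega)) (hY _) (hY _)
      (hprox (k + 1) (by omega)) (hfin k hk)) hmaxk hk
  change (P.D νs ≠ ⊥ ∧ P.D νs ≠ ⊤) ∧ (P.D (x k) ≠ ⊥ ∧ P.D (x k) ≠ ⊤) ∧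
    P.D νs - P.D (x k) ≤ _
  rw [hDs, hDx k hk]
  refine ⟨⟨EReal.coe_ne_bot _, EReal.coe_ne_top _⟩, ⟨EReal.coe_ne_bot _, EReal.coe_ne_top _⟩, ?_⟩
  rw [← EReal.coe_sub, EReal.coe_le_coe_iff]
  refine le_trans (le_of_eq ?_) hrate
  ring

/-! ### Existence of runs -/

lemma exists_isJointRun (hP : P.Assumptions)
    {L : ∀ i, Matrix (LocalIdx m p i) (LocalIdx m p i) ℝ} (hL : ∀ i, (L i).PosDef)
    (lam0 : ∀ i, Fin (m i) → ℝ) (mu0 : ∀ i, Fin (p i) → ℝ) :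
    ∃ S, P.IsJointRun L lam0 mu0 S := by
  choose Y hY using exists_isPrimalMin hP
  choose X hX using fun (z : DualIdx m p → ℝ) (i : Fin M) =>
    exists_isProx_conjG hP i (hL i) (Sum.elim (fun a => z ⟨i, Sum.inl a⟩)
      (fun a => z ⟨i, Sum.inr a⟩) + (L i)⁻¹ *ᵥ Sum.elim (P.resA (Y z) i) (P.resB (Y z) i))
  let next : (DualIdx m p → ℝ) × (DualIdx m p → ℝ) × ℝ →
      (DualIdx m p → ℝ) × (DualIdx m p → ℝ) × ℝ := fun q =>
    let x' : DualIdx m p → ℝ := fun s => X q.2.1 s.1 s.2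
    let t' := (1 + √(1 + 4 * q.2.2 ^ 2)) / 2
    (x', x' + ((q.2.2 - 1) / t') • (x' - q.1), t')
  -- The state `st k` is `(ν^k, z^{k+1}, t^{k+1})`, whence the shift `k - 1` below for `y`, `z`, `v`
  -- and `t`.
  let st : ℕ → (DualIdx m p → ℝ) × (DualIdx m p → ℝ) × ℝ :=
    fun k => next^[k] (stack lam0 mu0, stack lam0 mu0, 1)
  have hst : ∀ k, st (k + 1) = next (st k) := fun k => Function.iterate_succ_apply' _ _ _
  refine ⟨{ y := fun k => Y (st (k - 1)).2.1
            lam := fun k i a => (st k).1 ⟨i, Sum.inl a⟩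
            mu := fun k i a => (st k).1 ⟨i, Sum.inr a⟩
            z := fun k i a => (st (k - 1)).2.1 ⟨i, Sum.inl a⟩
            v := fun k i a => (st (k - 1)).2.1 ⟨i, Sum.inr a⟩
            t := fun k => (st (k - 1)).2.2 },
    { lam_init := rfl, mu_init := rfl, z_init := rfl, v_init := rfl, t_init := rfl,
      y_step := ?_, t_step := ?_, z_step := ?_, v_step := ?_, dual_step := ?_ }⟩
  all_goals
    intro k hk
    obtain ⟨k, rfl⟩ := Nat.exists_eq_add_of_le' hk
    simp only [Nat.add_sub_cancel]
  · refine (isPrimalMin_stack_iff _ _ _).1 ?_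
    convert hY (st k).2.1 using 1
    ext ⟨i, a | a⟩ <;> rfl
  · rw [hst]
  · intro i
    rw [hst]
    rfl
  · intro i
    rw [hst]
    rfl
  · intro i
    convert hX (st k).2.1 i using 1
    · rfl
    · rw [hst]
      ext (a | a) <;> rfl

/-! ### The separate updates -/

/-- The diagonal blocks inherit positive definiteness, and `L_i⁻¹` is block diagonal too, so the
prox argument splits. As `g_i⋆` ignores `λ_i`, the prox is the identity in that component. -/
lemma isSplitRun_iff (hP : P.Assumptions) {Ll : ∀ i, Matrix (Fin (m i)) (Fin (m i)) ℝ}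
    {Lm : ∀ i, Matrix (Fin (p i)) (Fin (p i)) ℝ}
    {L : ∀ i, Matrix (LocalIdx m p i) (LocalIdx m p i) ℝ} (hL : ∀ i, (L i).PosDef)
    (hLb : ∀ i, L i = Matrix.fromBlocks (Ll i) 0 0 (Lm i))
    {lam0 : ∀ i, Fin (m i) → ℝ} {mu0 : ∀ i, Fin (p i) → ℝ} {S : Iterates n m p} :
    P.IsSplitRun Ll Lm lam0 mu0 S ↔ P.IsJointRun L lam0 mu0 S := by
  have hLl : ∀ i, (Ll i).PosDef := fun i => by
    have := hL i
    rw [hLb] at this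
    exact this.submatrix Sum.inl_injective
  have hLm : ∀ i, (Lm i).PosDef := fun i => by
    have := hL i
    rw [hLb] at this
    exact this.submatrix Sum.inr_injective
  have hstep : ∀ k i, IsProx (P.conjG i) (L i)
      (Sum.elim (S.z k i) (S.v k i) +
        (L i)⁻¹ *ᵥ Sum.elim (P.resA (S.y k) i) (P.resB (S.y k) i))
      (Sum.elim (S.lam k i) (S.mu k i)) ↔
      S.lam k i = S.z k i + (Ll i)⁻¹ *ᵥ P.resA (S.y k) i ∧
      IsProx (conj (P.g i)) (Lm i) (S.v k i + (Lm i)⁻¹ *ᵥ P.resB (S.y k) i) (S.mu k i) := by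
    intro k i
    have hinv : (L i)⁻¹ = Matrix.fromBlocks (Ll i)⁻¹ 0 0 (Lm i)⁻¹ := by
      rw [hLb, Matrix.inv_fromBlocks_zero₂₁_of_isUnit_iff _ _ _
        (iff_of_true (hLl i).isUnit (hLm i).isUnit)]
      simp
    rw [← isProx_fromBlocks_iff ((hP.g_proper i).conj (hP.g_closed i) (hP.g_convex i)) (hLl i),
      hinv, hLb, Matrix.fromBlocks_mulVec]
    simp only [Sum.elim_comp_inl, Sum.elim_comp_inr, Matrix.zero_mulVec, add_zero, zero_add,
      ← Sum.elim_add_add]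
    rfl
  constructor
  · intro h
    exact { h.toCommonSteps with
      dual_step := fun k hk i => (hstep k i).2 ⟨h.lam_step k hk i, h.mu_step k hk i⟩ }
  · intro h
    exact { h.toCommonSteps with
      lam_step := fun k hk i => ((hstep k i).1 (h.dual_step k hk i)).1
      mu_step := fun k hk i => ((hstep k i).1 (h.dual_step k hk i)).2 }

end Problem

end DualMPC

end

theorem mainTheorem5 {M : ℕ} (n m p : Fin M → ℕ) (P : DualMPC.Problem n m p)
    (hP : P.Assumptions)
    (K : ∀ _ j : Fin M, Matrix (DualMPC.LocalIdx m p j) (DualMPC.LocalIdx m p j) ℝ)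
    (hK : ∀ i, Matrix.blockDiagonal' (fun j : {j // j ∈ P.nbrM i} => K i j.1) ∈ P.locSet i) :
    (Matrix.blockDiagonal' (P.initL K) - P.fullC * P.fullH⁻¹ * P.fullCᵀ).PosSemidef ∧
    ((∀ i, (P.initL K i).PosDef) →
      ∀ (lam0 : ∀ i, Fin (m i) → ℝ) (mu0 : ∀ i, Fin (p i) → ℝ),
        ((∃ S, P.IsJointRun (P.initL K) lam0 mu0 S) ∧
          ∀ S, P.IsJointRun (P.initL K) lam0 mu0 S → P.HasRate (P.initL K) S) ∧
        ∀ (Ll : ∀ i, Matrix (Fin (m i)) (Fin (m i)) ℝ)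
          (Lm : ∀ i, Matrix (Fin (p i)) (Fin (p i)) ℝ),
          (∀ i, P.initL K i = Matrix.fromBlocks (Ll i) 0 0 (Lm i)) →
            (∃ S, P.IsSplitRun Ll Lm lam0 mu0 S) ∧
            ∀ S, P.IsSplitRun Ll Lm lam0 mu0 S → P.HasRate (P.initL K) S) := by
  have hLC := P.posSemidef_initL_sub (fun i => (hP.strong i).1) hK
  refine ⟨hLC, fun hL lam0 mu0 => ?_⟩
  have hrun := DualMPC.Problem.exists_isJointRun hP hL lam0 mu0
  refine ⟨⟨hrun, fun S hS => hS.hasRate hP hL hLC⟩, fun Ll Lm hLb => ?_⟩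
  simp only [DualMPC.Problem.isSplitRun_iff hP hL hLb]
  exact ⟨hrun, fun S hS => hS.hasRate hP hL hLC⟩
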